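/- Let $p$ be a prime, $s\ge 2$, and let $t_1\ge 1$, $t_2,\dots,t_{s-1}\ge 0$, $t_s\ge 1$ be integers. Let ${\cal H}={\cal H}_p^{t_1,\dots,t_s}\le \mathbb{Z}_p^{\alpha_1}\times\mathbb{Z}_{p^2}^{\alpha_2}\times\cdots\times\mathbb{Z}_{p^s}^{\alpha_s}$ be the $\mathbb{Z}_p\mathbb{Z}_{p^2}\cdots\mathbb{Z}_{p^s}$-additive generalized Hadamard (GH) code generated by the rows of the matrix $A_p^{t_1,\dots,t_s}$ defined below, let ${\cal H}_p=\{u\in{\cal H}: o(u)\le p\}$ be the set of codewords of (additive) order at most $p$, and let $\Phi$ be the Gray map defined below. If the code $\Phi({\cal H})$ is nonlinear, i.e. not a $\mathbb{Z}_p$-subspace, then $$K(\Phi({\cal H}))=\Phi({\cal H}_p),\qquad\text{where } K(C)=\{x\in\mathbb{Z}_p^n: x+C=C\}\text{ for } C\subseteq\mathbb{Z}_p^n .$$ *Gray map.* For $u=\sum_{i=0}^{r-1}u_ip^i\in\mathbb{Z}_{p^r}$ with $0\le u_i<p$, put $\phi_r(u)=(u_{r-1},\dots,u_{r-1})+(u_0,\dots,u_{r-2})Y_{r-1}\in\mathbb{Z}_p^{p^{r-1}}$,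 where the columns of the $(r-1)\times p^{r-1}$ matrix $Y_{r-1}$ are all the vectors $(y_0,\dots,y_{r-2})^T$ with entries in $\mathbb{Z}_p$, ordered by $\sum_k y_kp^k$. The map $\Phi:\mathbb{Z}_p^{\alpha_1}\times\cdots\times\mathbb{Z}_{p^s}^{\alpha_s}\to\mathbb{Z}_p^n$, $n=\sum_r p^{r-1}\alpha_r$, applies $\phi_r$ to each coordinate in $\mathbb{Z}_{p^r}$. *Generator matrix.* All matrices below have the form $A=(A_1\mid\cdots\mid A_s)$ with $A_r$ over $\mathbb{Z}_{p^r}$, and a bold $\mathbf b$ denotes the row vector with all entries $b$. The matrix $A_p^{1,0,\dots,0,1}$ has two rows. Its block over $\mathbb{Z}_p$ has the columns $(1,b)^T$, $0\le b\le p-1$, and its block over $\mathbb{Z}_{p^r}$, $2\le r\le s$, has the columns $(p^{r-1},b)^T$, $1\le b\le p-1$. For $1\le i\le s$, the $i$-th construction turns a matrix $A$ with $m$ rows into the matrix $(A'_1\mid\cdots\mid A'_s)$ with $m+1$ rows given by - $A'_1=\begin{pmatrix}A_1&\cdots&A_1\\ \mathbf 0&\cdots&\mathbf{p-1}\end{pmatrix}$;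 - $A'_{j+1}=\begin{pmatrix}M_j&\cdots&M_j&A_{j+1}&\cdots&A_{j+1}\\ \mathbf 1&\cdots&\mathbf{p-1}&\mathbf 0&\cdots&\mathbf{p^{j+1}-1}\end{pmatrix}$ for $1\le j\le s-i$, where the columns of $M_j$ are all the elements of $\{p^j\}\times\{p\cdot 0,p\cdot 1,\dots,p(p^j-1)\}^{m-1}$ in lexicographic order; - $A'_{s-i+1+k}=\begin{pmatrix}A_{s-i+1+k}&\cdots&A_{s-i+1+k}\\ p^k\cdot\mathbf 0&\cdots&p^k\cdot(\mathbf{p^{s-i+1}-1})\end{pmatrix}$ for $1\le k\le i-1$. The matrix $A_p^{t_1,\dots,t_s}$ is obtained from $A_p^{1,0,\dots,0,1}$ by applying the first construction $t_1-1$ times, then, for $i=2,\dots,s-1$ in this order, the $i$-th construction $t_i$ times, and finally the $s$-th construction $t_s-1$ times. -/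

import Mathlib

namespace GHCode

/-! ### Mixed alphabets

The blocks are numbered from `0`: block `r : Fin s` is the one over `ℤ / p ^ (r + 1)`. -/

/-- A matrix with `n` rows `(A₁ ∣ ⋯ ∣ A_s)`, given block by block as a list of columns: the
columns of block `r : Fin s` have entries in `ℤ / p ^ (r + 1)`. -/
abbrev GenMatrix (p s n : ℕ) : Type :=
  (r : Fin s) → List (Fin n → ZMod (p ^ (r.val + 1)))

/-- The group `ℤ_p ^ α₁ × ℤ_{p²} ^ α₂ × ⋯ × ℤ_{p^s} ^ α_s`. -/
abbrev MixedSpace (p s : ℕ) (α : Fin s → ℕ) : Type :=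
  (r : Fin s) → Fin (α r) → ZMod (p ^ (r.val + 1))

/-! ### The generator matrices -/

/-- The matrix with the two rows `(1 ⋯ 1 ∣ p ⋯ p ∣ ⋯ ∣ p^(s-1) ⋯ p^(s-1))` and
`(0 1 ⋯ p-1 ∣ 1 ⋯ p-1 ∣ ⋯ ∣ 1 ⋯ p-1)`. -/
def baseMatrix (p s : ℕ) : GenMatrix p s 2 := fun r =>
  (if r.val = 0 then List.range p else List.range' 1 (p - 1)).map
    fun b => ![(p : ZMod (p ^ (r.val + 1))) ^ r.val, (b : ZMod (p ^ (r.val + 1)))]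

/-- All `m`-tuples with entries in the list `L`, in lexicographic order. -/
def tuples {R : Type*} (L : List R) : (m : ℕ) → List (Fin m → R)
  | 0 => [Fin.elim0]
  | m + 1 => L.flatMap fun a => (tuples L m).map fun z => Fin.cons a z

/-- The columns of the matrix `M_j` with `m + 1` rows over `ℤ / p ^ (j + 1)`: all the vectors in
`{p ^ j} × {p * 0, p * 1, …, p * (p ^ j - 1)} ^ m`. -/
def mColumns (p j m : ℕ) : List (Fin (m + 1) → ZMod (p ^ (j + 1))) :=
  (tuples ((List.range (p ^ j)).map fun a => (p : ZMod (p ^ (j + 1))) * (a : ZMod (p ^ (j + 1))))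
    m).map fun z => Fin.cons ((p : ZMod (p ^ (j + 1))) ^ j) z

/-- The list of columns obtained by writing `b` below each column in `cols`. -/
def appendRow {R : Type*} {n : ℕ} (cols : List (Fin n → R)) (b : R) : List (Fin (n + 1) → R) :=
  cols.map fun c => Fin.snoc (α := fun _ => R) c b

/-- The `i`-th construction, which adds a row of order `p ^ (s - i + 1)`; here `i = i₀ + 1` with
`i₀ : Fin s`.
* Block `1` becomes `A₁ ⋯ A₁` over `0, …, p - 1`.
* Block `j + 1` with `1 ≤ j ≤ s - i` becomes `M_j ⋯ M_j` over `1, …, p - 1`, followed by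
  `A_{j+1} ⋯ A_{j+1}` over `0, …, p ^ (j + 1) - 1`.
* Block `s - i + 1 + k` with `1 ≤ k ≤ i - 1` becomes that block of `A`, repeated over
  `p ^ k * 0, …, p ^ k * (p ^ (s - i + 1) - 1)`. -/
def addRow {p s n : ℕ} (i₀ : Fin s) (A : GenMatrix p s (n + 1)) : GenMatrix p s (n + 2) := fun r =>
  if r.val = 0 then
    (List.range p).flatMap fun b => appendRow (A r) (b : ZMod (p ^ (r.val + 1)))
  else if r.val + i₀.val < s then
    ((List.range' 1 (p - 1)).flatMap fun b =>
      appendRow (mColumns p r.val n) (b : ZMod (p ^ (r.val + 1)))) ++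
    ((List.range (p ^ (r.val + 1))).flatMap fun b =>
      appendRow (A r) (b : ZMod (p ^ (r.val + 1))))
  else
    (List.range (p ^ (s - i₀.val))).flatMap fun b =>
      appendRow (A r)
        ((p : ZMod (p ^ (r.val + 1))) ^ (r.val + i₀.val + 1 - s) * (b : ZMod (p ^ (r.val + 1))))

/-- The matrix obtained from the base matrix by the constructions in a list, the last entry of the
list being applied first. -/
def buildMatrix (p s : ℕ) : (l : List (Fin s)) → GenMatrix p s (l.length + 2)
  | [] => baseMatrix p s
  | i₀ :: l => addRow i₀ (buildMatrix p s l)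

/-- The constructions leading to the type `t`, in the order of their application: first the first
construction `t₁ - 1` times, then the `i`-th one `t_i` times for `i = 2, …, s - 1`, then the last
one `t_s - 1` times (for `s ≥ 2` and `t₁, t_s ≥ 1`). -/
def steps (s : ℕ) (t : Fin s → ℕ) : List (Fin s) :=
  (List.finRange s).flatMap fun i₀ =>
    List.replicate (if i₀.val = 0 ∨ i₀.val + 1 = s then t i₀ - 1 else t i₀) i₀

/-- The generator matrix `A_p^{t₁, …, t_s}`. -/
def genMatrix (p s : ℕ) (t : Fin s → ℕ) : GenMatrix p s ((steps s t).reverse.length + 2) :=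
  buildMatrix p s (steps s t).reverse

/-! ### Additive codes -/

/-- The number of columns in each block. -/
def GenMatrix.numCols {p s n : ℕ} (A : GenMatrix p s n) : Fin s → ℕ := fun r => (A r).length

/-- The `k`-th row of a matrix. -/
def GenMatrix.row {p s n : ℕ} (A : GenMatrix p s n) (k : Fin n) :
    MixedSpace p s (GenMatrix.numCols A) :=
  fun r c => (A r).get c k

/-- The additive code generated by (the rows of) a matrix. -/
def GenMatrix.code {p s n : ℕ} (A : GenMatrix p s n) :
    AddSubgroup (MixedSpace p s (GenMatrix.numCols A)) :=
  AddSubgroup.closure (Set.range (GenMatrix.row A))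

/-- The numbers `α₁, …, α_s` of columns in the blocks of `A_p^{t₁, …, t_s}`. -/
def ghLengths (p s : ℕ) (t : Fin s → ℕ) : Fin s → ℕ := GenMatrix.numCols (genMatrix p s t)

/-- The additive code `ℋ_p^{t₁, …, t_s}`. -/
def ghCode (p s : ℕ) (t : Fin s → ℕ) : AddSubgroup (MixedSpace p s (ghLengths p s t)) :=
  GenMatrix.code (genMatrix p s t)

/-- The codewords of order at most `m` in an additive code. -/
def wordsOfOrderLE {G : Type*} [AddGroup G] (H : AddSubgroup G) (m : ℕ) : Set G :=
  {u | u ∈ H ∧ addOrderOf u ≤ m}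

/-! ### The Gray map -/

/-- The `k`-th digit in the `p`-ary expansion of `x`. -/
def digit (p k x : ℕ) : ℕ := x / p ^ k % p

/-- The Gray map `φ_{r+1} : ℤ / p ^ (r + 1) → ℤ_p ^ (p ^ r)`,
`φ_{r+1}(u) = (u_r, …, u_r) + (u_0, …, u_{r-1}) Y_r`; column `c` of `Y_r` is the `p`-ary expansion
of `c`, least significant digit first. -/
def gray (p r : ℕ) (u : ZMod (p ^ (r + 1))) : Fin (p ^ r) → ZMod p := fun c =>
  (digit p r u.val : ZMod p) +
    ∑ k : Fin r, (digit p k.val u.val : ZMod p) * (digit p k.val c.val : ZMod p)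

/-- The `α₁ + p α₂ + ⋯ + p ^ (s-1) α_s` coordinates of the Gray images: block, position in the
block, and position in the Gray image of that entry. -/
abbrev GrayCoord (p s : ℕ) (α : Fin s → ℕ) : Type :=
  (r : Fin s) × (Fin (α r) × Fin (p ^ r.val))

/-- The Gray map `Φ` on `ℤ_p ^ α₁ × ⋯ × ℤ_{p^s} ^ α_s`. -/
def grayMap (p s : ℕ) (α : Fin s → ℕ) (y : MixedSpace p s α) : GrayCoord p s α → ZMod p :=
  fun x => gray p x.1.val (y x.1 x.2.1) x.2.2

/-! ### Codes over `ℤ_p` -/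

/-- A code over `ℤ_p` is linear if it is a subspace. -/
def IsLinearCode {p : ℕ} {ι : Type*} (C : Set (ι → ZMod p)) : Prop :=
  ∃ W : Submodule (ZMod p) (ι → ZMod p), (W : Set (ι → ZMod p)) = C

/-- The kernel `{x : x + C = C}` of a code `C`. -/
def codeKernel {p : ℕ} {ι : Type*} (C : Set (ι → ZMod p)) : Set (ι → ZMod p) :=
  {x | (fun c => x + c) '' C = C}

end GHCode

namespace GHCode

/-! ### The Gray map -/

/-! If `p • u = 0`, the entries of `u` in block `r` are multiples of `p ^ r`. Adding them changes
only leading digits, so Φ(u + v) = Φ(u) + Φ(v) for all v, and Φ(ℋ_p) lies in the kernel. Conversely,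
0 ∈ Φ(ℋ), so a kernel element is Φ(u) with u ∈ ℋ, and every v ∈ ℋ has some w ∈ ℋ with Φ(u) + Φ(v) =
Φ(w). If pu ≠ 0, then p = 2 and only one row has order above 2 (`eq_two_and_rowExp_le_one`); but
then Φ(ℋ) is closed under addition (`exists_isGraySum`), against nonlinearity.

Up to factors congruent to 1 mod p, the columns of block r are the vectors (p^r, z) with z
`Admissible` (`exists_column_mem`, `eq_column_of_mem`). In the first block r = q + 1 where pu ≠ 0,
the row of z contributes p^q X to u, with p ∤ X for some z. If v contributes p^q Y, then w - u - v
contributes -p^(q+1) carry(X, Y) modulo p^(q+2) (`gray_carry`). This must be additive in z. For v =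
-u the carry is 1 both at z and, when p is odd, at 2z, which is absurd. For p = 2 the carry is XY
mod 2, and testing with multiples v of a single row excludes a second row of order above 2
(`false_of_rowExp_ge`, `false_of_rowExp_le`). -/

theorem digit_mod (p r k x : ℕ) (h : k ≤ r) : digit p k (x % p ^ (r + 1)) = digit p k x := by
  unfold digit
  obtain ⟨d, rfl⟩ := Nat.exists_eq_add_of_le h
  rw [show p ^ (k + d + 1) = p ^ k * p ^ (d + 1) by ring, Nat.mod_mul_right_div_self,
    Nat.mod_mod_of_dvd _ (dvd_pow_self p (Nat.succ_ne_zero d))]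

theorem gray_natCast (p r x : ℕ) (c : Fin (p ^ r)) :
    gray p r (x : ZMod (p ^ (r + 1))) c = (digit p r x : ZMod p) +
      ∑ k : Fin r, (digit p k.val x : ZMod p) * (digit p k.val c.val : ZMod p) := by
  unfold gray
  rw [ZMod.val_natCast, digit_mod p r r x le_rfl]
  congr 1
  exact Finset.sum_congr rfl fun k _ => by rw [digit_mod p r k.val x k.isLt.le]

theorem gray_zero (p r : ℕ) : gray p r 0 = 0 := by
  funext c
  have := gray_natCast p r 0 c
  simpa [digit] using this

theorem eq_of_digit_eq {p n x y : ℕ} (hx : x < p ^ n) (hy : y < p ^ n)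
    (h : ∀ k < n, digit p k x = digit p k y) : x = y := by
  have key : ∀ j ≤ n, x % p ^ j = y % p ^ j := by
    intro j
    induction j with
    | zero => intro _; simp [Nat.mod_one]
    | succ j ih =>
      intro hj
      rw [Nat.mod_pow_succ, Nat.mod_pow_succ, ih (by omega)]
      have := h j (by omega)
      unfold digit at this
      rw [this]
  have := key n le_rfl
  rwa [Nat.mod_eq_of_lt hx, Nat.mod_eq_of_lt hy] at this

theorem digit_zero (p k : ℕ) : digit p k 0 = 0 := by simp [digit]

theorem digit_pow {p : ℕ} (hp : 1 < p) (k j : ℕ) : digit p k (p ^ j) = if k = j then 1 else 0 := by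
  unfold digit
  rcases lt_trichotomy k j with h | h | h
  · obtain ⟨d, rfl⟩ := Nat.exists_eq_add_of_lt h
    rw [show p ^ (k + d + 1) = p ^ k * (p * p ^ d) by ring,
      Nat.mul_div_cancel_left _ (by positivity)]
    simp [h.ne]
  · subst h
    rw [Nat.div_self (by positivity)]
    simp [Nat.mod_eq_of_lt hp]
  · rw [Nat.div_eq_of_lt (Nat.pow_lt_pow_right hp h)]
    simp [h.ne']

theorem natCast_digit_inj {p k x y : ℕ} 
    (h : (digit p k x : ZMod p) = (digit p k y : ZMod p)) : digit p k x = digit p k y := by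
  rw [ZMod.natCast_eq_natCast_iff'] at h
  simpa [digit] using h

/-- Column 0 of the matrix Y is zero and isolates the leading digit; column `p ^ k` is a unit vector
and isolates digit `k`. -/
theorem gray_injective {p : ℕ} (hp : 1 < p) (r : ℕ) : Function.Injective (gray p r) := by
  intro u v h
  have : NeZero (p ^ (r + 1)) := ⟨by positivity⟩
  have htop : (digit p r u.val : ZMod p) = digit p r v.val := by
    have := congrFun h ⟨0, by positivity⟩
    simpa [gray, digit_zero] using this
  have hlow : ∀ k < r, (digit p k u.val : ZMod p) = digit p k v.val := by
    intro k hk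
    have := congrFun h ⟨p ^ k, Nat.pow_lt_pow_right hp hk⟩
    simp only [gray, digit_pow hp, htop, add_right_inj] at this
    have aux : ∀ x : ℕ, ∑ j : Fin r, (digit p j.val x : ZMod p) *
        ((if j.val = k then 1 else 0 : ℕ) : ZMod p) = digit p k x := by
      intro x
      rw [Finset.sum_eq_single (⟨k, hk⟩ : Fin r)]
      · simp
      · intro j _ hj
        have : j.val ≠ k := fun e => hj (Fin.ext e)
        simp [this]
      · simp
    rwa [aux, aux] at this
  apply ZMod.val_injective
  refine eq_of_digit_eq (ZMod.val_lt u) (ZMod.val_lt v) fun k hk => ?_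
  apply natCast_digit_inj
  rcases Nat.lt_succ_iff_lt_or_eq.mp hk with h' | rfl
  · exact hlow k h'
  · exact htop

/-- Adding a multiple of `p ^ r` only changes the leading digit. -/
theorem gray_pow_mul_add {p : ℕ} (hp : 1 < p) (r a x : ℕ) :
    gray p r ((p ^ r * a + x : ℕ) : ZMod (p ^ (r + 1))) =
      fun c => (a : ZMod p) + gray p r (x : ZMod (p ^ (r + 1))) c := by
  funext c
  rw [gray_natCast, gray_natCast, ← add_assoc]
  congr 1
  · unfold digit
    rw [Nat.mul_add_div (by positivity)]
    simp
  · refine Finset.sum_congr rfl fun k _ => ?_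
    congr 2
    unfold digit
    obtain ⟨d, hd⟩ := Nat.exists_eq_add_of_lt k.isLt
    rw [show p ^ r * a = p ^ k.val * (p * (p ^ d * a)) by
      conv_lhs => rw [hd]
      ring, Nat.mul_add_div (by positivity), Nat.mul_add_mod]

theorem exists_eq_pow_mul {p r : ℕ} (hp : 1 < p) {u : ZMod (p ^ (r + 1))}
    (hu : (p : ZMod _) * u = 0) :
    ∃ a : ℕ, u = ((p ^ r * a : ℕ) : ZMod (p ^ (r + 1))) := by
  have : NeZero (p ^ (r + 1)) := ⟨by positivity⟩
  have h : ((p * u.val : ℕ) : ZMod (p ^ (r + 1))) = 0 := by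
    rw [Nat.cast_mul, ZMod.natCast_val, ZMod.cast_id, hu]
  rw [ZMod.natCast_eq_zero_iff] at h
  have h' : p * p ^ r ∣ p * u.val := by rwa [← pow_succ']
  obtain ⟨a, ha⟩ := Nat.dvd_of_mul_dvd_mul_left (by omega) h'
  exact ⟨a, by rw [← ha, ZMod.natCast_val, ZMod.cast_id]⟩

theorem gray_add_of_torsion {p r : ℕ} (hp : 1 < p) {u : ZMod (p ^ (r + 1))}
    (hu : (p : ZMod _) * u = 0) (v : ZMod (p ^ (r + 1))) :
    gray p r (u + v) = gray p r u + gray p r v := by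
  have : NeZero (p ^ (r + 1)) := ⟨by positivity⟩
  obtain ⟨a, rfl⟩ := exists_eq_pow_mul hp hu
  have h1 := gray_pow_mul_add hp r a v.val
  have h2 := gray_pow_mul_add hp r a 0
  rw [Nat.cast_add, ZMod.natCast_val, ZMod.cast_id] at h1
  rw [add_zero, Nat.cast_zero, gray_zero] at h2
  rw [h1, h2]
  funext c
  simp

/-- The carry from the last digits in the sum of `x` and `y`. -/
def carry (p : ℕ) (x y : ℤ) : ℤ := if (p : ℤ) ≤ x % p + y % p then 1 else 0

theorem carry_congr {p : ℕ} {x x' y y' : ℤ} (hx : (p : ℤ) ∣ x - x') (hy : (p : ℤ) ∣ y - y') :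
    carry p x y = carry p x' y' := by
  unfold carry
  rw [(Int.emod_eq_emod_iff_emod_sub_eq_zero).2 (Int.emod_eq_zero_of_dvd hx),
    (Int.emod_eq_emod_iff_emod_sub_eq_zero).2 (Int.emod_eq_zero_of_dvd hy)]

/-- Modulo `p ^ (q + 2)`, a multiple of `p ^ q` has only the digits `q` and `q + 1`, namely `x` and
`x / p` modulo `p`. -/
theorem gray_pow_mul {p : ℕ} (hp : 0 < p) (q x : ℕ) (c : Fin (p ^ (q + 1))) :
    gray p (q + 1) ((p ^ q * x : ℕ) : ZMod (p ^ (q + 1 + 1))) c =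
      ((x / p : ℕ) : ZMod p) + (x : ZMod p) * (digit p q c.val : ZMod p) := by
  rw [gray_natCast]
  congr 1
  · unfold digit
    rw [pow_succ, Nat.mul_div_mul_left _ _ (by positivity), ZMod.natCast_mod]
  · rw [Fin.sum_univ_castSucc, Finset.sum_eq_zero, zero_add]
    · congr 1
      unfold digit
      simp only [Fin.val_last]
      rw [Nat.mul_div_cancel_left _ (by positivity), ZMod.natCast_mod]
    · intro k _
      have hk := k.isLt
      obtain ⟨d, hd⟩ := Nat.exists_eq_add_of_lt hk
      have : digit p k.val (p ^ q * x) = 0 := by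
        unfold digit
        rw [show p ^ q * x = p ^ k.val * (p * (p ^ d * x)) by
          conv_lhs => rw [hd]
          ring, Nat.mul_div_cancel_left _ (by positivity), Nat.mul_mod_right]
      simp [this]

/-- Gray images add digits without carrying, so the carry into digit `q + 1` has to be cancelled.
Adding it `p - 1` times instead of subtracting it keeps everything in ℕ. -/
theorem gray_carry_nat {p : ℕ} (hp : 1 < p) (q x y : ℕ) :
    gray p (q + 1) ((p ^ q * (x + y + p * ((p - 1) * if p ≤ x % p + y % p then 1 else 0)) : ℕ) :
        ZMod (p ^ (q + 1 + 1))) =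
      gray p (q + 1) ((p ^ q * x : ℕ) : ZMod (p ^ (q + 1 + 1))) +
        gray p (q + 1) ((p ^ q * y : ℕ) : ZMod (p ^ (q + 1 + 1))) := by
  have hp0 : 0 < p := by omega
  funext c
  rw [Pi.add_apply, gray_pow_mul hp0, gray_pow_mul hp0, gray_pow_mul hp0,
    Nat.add_mul_div_left _ _ hp0, Nat.add_div hp0]
  have h1 : ((p - 1 : ℕ) : ZMod p) = -1 := by
    rw [Nat.cast_sub hp.le]
    simp
  push_cast
  rw [h1]
  split_ifs <;> simp <;> ring

/-- The sum of two Gray images, for elements with at most two nonzero digits. -/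
theorem gray_carry {p : ℕ} (hp : 1 < p) (q : ℕ) (X Y : ℤ) :
    gray p (q + 1) (((p : ℤ) ^ q * (X + Y) - (p : ℤ) ^ (q + 1) * carry p X Y : ℤ) :
        ZMod (p ^ (q + 1 + 1))) =
      gray p (q + 1) (((p : ℤ) ^ q * X : ℤ) : ZMod (p ^ (q + 1 + 1))) +
        gray p (q + 1) (((p : ℤ) ^ q * Y : ℤ) : ZMod (p ^ (q + 1 + 1))) := by
  -- Multiples of `p ^ 2` vanish after multiplication by `p ^ q`, so natural representatives
  -- suffice.
  have rep : ∀ Z : ℤ, ∃ z : ℕ, ∃ k : ℤ, Z = z + (p : ℤ) ^ 2 * k := fun Z =>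
    ⟨(Z % (p : ℤ) ^ 2).toNat, Z / (p : ℤ) ^ 2, by
      rw [Int.toNat_of_nonneg (Int.emod_nonneg _ (by positivity)), Int.emod_add_mul_ediv]⟩
  obtain ⟨x, k, rfl⟩ := rep X
  obtain ⟨y, l, rfl⟩ := rep Y
  have hc : carry p (x + (p : ℤ) ^ 2 * k) (y + (p : ℤ) ^ 2 * l) =
      ((if p ≤ x % p + y % p then 1 else 0 : ℕ) : ℤ) := by
    rw [carry_congr (x' := x) (y' := y) ⟨p * k, by ring⟩ ⟨p * l, by ring⟩]
    unfold carry
    norm_cast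
  have cast : ∀ a b : ℤ, (p : ℤ) ^ (q + 1 + 1) ∣ b - a →
      (a : ZMod (p ^ (q + 1 + 1))) = (b : ZMod (p ^ (q + 1 + 1))) := fun a b h =>
    (ZMod.intCast_eq_intCast_iff_dvd_sub a b _).2 (by exact_mod_cast h)
  have hp1 : ((p - 1 : ℕ) : ℤ) = p - 1 := by
    rw [Nat.cast_sub hp.le, Nat.cast_one]
  generalize hκ : (if p ≤ x % p + y % p then 1 else 0 : ℕ) = κ at hc
  have h := gray_carry_nat hp q x y
  rw [hκ] at h
  rw [hc, cast ((p : ℤ) ^ q * (x + (p : ℤ) ^ 2 * k)) ((p ^ q * x : ℕ) : ℤ)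
      ⟨-k, by push_cast; ring⟩,
    cast ((p : ℤ) ^ q * (y + (p : ℤ) ^ 2 * l)) ((p ^ q * y : ℕ) : ℤ) ⟨-l, by push_cast; ring⟩,
    cast _ ((p ^ q * (x + y + p * ((p - 1) * κ)) : ℕ) : ℤ) ⟨κ - k - l, by
      rw [Nat.cast_mul, Nat.cast_add, Nat.cast_mul p, Nat.cast_mul (p - 1), hp1]
      push_cast
      ring⟩]
  simp only [Int.cast_natCast]
  exact h

/-! ### The columns of the generator matrices -/

/-- The exponents of the orders of the rows of `buildMatrix p s l`, except for the first row. -/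
def rowExp (s : ℕ) : (l : List (Fin s)) → Fin (l.length + 1) → ℕ
  | [] => fun _ => s
  | i₀ :: l => Fin.snoc (α := fun _ => ℕ) (rowExp s l) (s - i₀.val)

/-- The column of block `r` that consists of `p ^ r` and the entries of `z`. -/
def column (p r : ℕ) {n : ℕ} (z : Fin n → ℤ) : Fin (n + 1) → ZMod (p ^ (r + 1)) :=
  Fin.cons ((p : ZMod (p ^ (r + 1))) ^ r) fun k => (z k : ZMod (p ^ (r + 1)))

theorem column_snoc (p r : ℕ) {n : ℕ} (z : Fin n → ℤ) (a : ℤ) :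
    column p r (Fin.snoc (α := fun _ => ℤ) z a) =
      Fin.snoc (α := fun _ => ZMod (p ^ (r + 1))) (column p r z) (a : ZMod (p ^ (r + 1))) := by
  unfold column
  rw [← Fin.cons_snoc_eq_snoc_cons]
  congr 1
  funext k
  refine Fin.lastCases ?_ (fun k => ?_) k <;> simp

theorem mem_tuples {R : Type*} (L : List R) {m : ℕ} {z : Fin m → R} :
    z ∈ tuples L m ↔ ∀ k, z k ∈ L := by
  induction m with
  | zero =>
    simp only [tuples, List.mem_singleton, IsEmpty.forall_iff, iff_true]
    exact Subsingleton.elim _ _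
  | succ m ih =>
    simp only [tuples, List.mem_flatMap, List.mem_map, ih, Fin.forall_fin_succ]
    constructor
    · rintro ⟨a, ha, y, hy, rfl⟩
      simpa using ⟨ha, hy⟩
    · rintro ⟨h0, h⟩
      exact ⟨z 0, h0, Fin.tail z, h, Fin.cons_self_tail z⟩

theorem mem_appendRow {R : Type*} {n : ℕ} {cols : List (Fin n → R)} {b : R}
    {c : Fin (n + 1) → R} :
    c ∈ appendRow cols b ↔ ∃ d ∈ cols, Fin.snoc (α := fun _ => R) d b = c := by
  simp [appendRow]

theorem mem_mColumns {p j m : ℕ} (hp : 0 < p) {c : Fin (m + 1) → ZMod (p ^ (j + 1))} :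
    c ∈ mColumns p j m ↔ ∃ z : Fin m → ℤ, (∀ k, (p : ℤ) ∣ z k) ∧ column p j z = c := by
  have hp' : (0 : ℤ) < (p : ℤ) ^ j := by positivity
  unfold mColumns column
  simp only [List.mem_map, mem_tuples, List.bind_eq_flatMap, List.pure_def, List.mem_flatMap,
    List.mem_singleton, List.mem_range]
  constructor
  · rintro ⟨y, hy, rfl⟩
    choose a ha hy using hy
    choose b hb ha using ha
    refine ⟨fun k => p * (b k : ℤ), fun k => dvd_mul_right _ _, ?_⟩
    congr 1
    funext k
    rw [← hy, ha]
    push_cast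
    rfl
  · rintro ⟨z, hz, rfl⟩
    refine ⟨_, fun k => ?_, rfl⟩
    obtain ⟨a, ha⟩ := hz k
    refine ⟨_, ⟨(a % (p : ℤ) ^ j).toNat, ?_, rfl⟩, ?_⟩
    · zify
      rw [Int.toNat_of_nonneg (Int.emod_nonneg _ hp'.ne')]
      exact Int.emod_lt_of_pos a hp'
    · rw [← Int.cast_natCast (a % (p : ℤ) ^ j).toNat,
        Int.toNat_of_nonneg (Int.emod_nonneg _ hp'.ne'), ha, ← Int.cast_natCast p, ← Int.cast_mul,
        ZMod.intCast_eq_intCast_iff_dvd_sub, ← mul_sub]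
      push_cast
      rw [pow_succ']
      exact mul_dvd_mul_left _ Int.dvd_self_sub_emod

/-- The columns of block `r` come, up to a factor congruent to `1` modulo `p`, from the vectors
`z` that satisfy this condition. -/
def Admissible (p r : ℕ) {n : ℕ} (σ : Fin n → ℕ) (z : Fin n → ℤ) : Prop :=
  (∀ k, (p : ℤ) ^ (r + 1 - σ k) ∣ z k) ∧ (r = 0 ∨ ∃ k, ¬ (p : ℤ) ∣ z k)

/-- Take θ = a⁻¹ · (a mod p), with the inverse modulo `p ^ (r + 1)`; it is 1 mod p because a and its
remainder agree mod p. -/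
theorem exists_scale {p : ℕ} (hp : p.Prime) (r : ℕ) {a : ℤ} (ha : ¬ (p : ℤ) ∣ a) :
    ∃ θ : ℤ, (p : ℤ) ∣ θ - 1 ∧ ∃ b : ℕ, 1 ≤ b ∧ b < p ∧
      ((θ * a : ℤ) : ZMod (p ^ (r + 1))) = (b : ZMod (p ^ (r + 1))) := by
  have hcop : IsCoprime a ((p : ℤ) ^ (r + 1)) := by
    refine IsCoprime.pow_right (IsCoprime.symm ?_)
    exact (Nat.prime_iff_prime_int.1 hp).coprime_iff_not_dvd.2 ha
  obtain ⟨x, y, hxy⟩ := hcop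
  have hp0 : (0 : ℤ) < p := by exact_mod_cast hp.pos
  have hb0 := Int.emod_nonneg a hp0.ne'
  have hb1 := Int.emod_lt_of_pos a hp0
  have hb2 : a % p ≠ 0 := fun h => ha (Int.dvd_of_emod_eq_zero h)
  have hdvd : (p : ℤ) ∣ a - a % p := Int.dvd_self_sub_emod
  refine ⟨x * (a % p), ?_, (a % p).toNat, by omega, by omega, ?_⟩
  · obtain ⟨k, hk⟩ := hdvd
    refine ⟨-x * k - y * p ^ r, ?_⟩
    have : x * (a % p) - 1 = x * (a % p) - (x * a + y * p ^ (r + 1)) := by rw [hxy]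
    rw [this]
    linear_combination -x * hk
  · rw [← Int.cast_natCast (R := ZMod _), Int.toNat_of_nonneg hb0,
      ZMod.intCast_eq_intCast_iff_dvd_sub]
    push_cast
    exact ⟨y * (a % p), by linear_combination -(a % p) * hxy⟩

/-! ### Columns of the base matrix and of one construction, as integer vectors -/

theorem mem_baseMatrix {p s : ℕ} {r : Fin s} {c : Fin 2 → ZMod (p ^ (r.val + 1))} (hp : 0 < p) :
    c ∈ baseMatrix p s r ↔
      ∃ b : ℕ, b < p ∧ (r.val = 0 ∨ 1 ≤ b) ∧ column p r (fun _ : Fin 1 => (b : ℤ)) = c := by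
  have hcol : ∀ b : ℕ, column p r (fun _ : Fin 1 => (b : ℤ)) =
      ![(p : ZMod (p ^ (r.val + 1))) ^ r.val, (b : ZMod (p ^ (r.val + 1)))] := by
    intro b
    funext k
    fin_cases k <;> simp [column]
  simp only [baseMatrix, List.mem_map, List.bind_eq_flatMap, List.pure_def, List.mem_flatMap,
    List.mem_singleton, hcol]
  constructor
  · rintro ⟨_, ⟨b, hb, rfl⟩, rfl⟩
    refine ⟨b, ?_, ?_, rfl⟩ <;> split_ifs at hb with h <;>
      simp only [List.mem_range, List.mem_range'_1] at hb <;> omega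
  · rintro ⟨b, hb, hr, rfl⟩
    refine ⟨_, ⟨b, ?_, rfl⟩, rfl⟩
    split_ifs with h <;> simp only [List.mem_range, List.mem_range'_1] <;> omega

theorem exists_natCast_eq {p : ℕ} (hp : 0 < p) (e m : ℕ) (a : ℤ) (ha : (p : ℤ) ^ e ∣ a) :
    ∃ b < p ^ m, (p : ZMod (p ^ (e + m))) ^ e * (b : ZMod (p ^ (e + m))) =
      (a : ZMod (p ^ (e + m))) := by
  have hp' : (0 : ℤ) < (p : ℤ) ^ m := by positivity
  obtain ⟨k, rfl⟩ := ha
  refine ⟨(k % (p : ℤ) ^ m).toNat, ?_, ?_⟩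
  · zify
    rw [Int.toNat_of_nonneg (Int.emod_nonneg _ hp'.ne')]
    exact Int.emod_lt_of_pos k hp'
  · rw [← Int.cast_natCast (k % (p : ℤ) ^ m).toNat,
        Int.toNat_of_nonneg (Int.emod_nonneg _ hp'.ne'), ← Int.cast_natCast p, ← Int.cast_pow,
        ← Int.cast_mul, ZMod.intCast_eq_intCast_iff_dvd_sub, ← mul_sub]
    push_cast
    rw [pow_add]
    exact mul_dvd_mul_left _ Int.dvd_self_sub_emod

theorem exists_natCast_eq_of_int {p : ℕ} (hp : 0 < p) (m : ℕ) (a : ℤ) :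
    ∃ b < p ^ m, (b : ZMod (p ^ m)) = (a : ZMod (p ^ m)) := by
  have := exists_natCast_eq hp 0 m a (by simp)
  rw [Nat.zero_add] at this
  simpa using this

theorem mem_addRow_zero {p s n : ℕ} (hp : 0 < p) {i₀ : Fin s} {A : GenMatrix p s (n + 1)}
    {r : Fin s} (hr : r.val = 0) {c : Fin (n + 2) → ZMod (p ^ (r.val + 1))} :
    c ∈ addRow i₀ A r ↔ ∃ d ∈ A r, ∃ a : ℤ,
      Fin.snoc (α := fun _ => ZMod (p ^ (r.val + 1))) d (a : ZMod (p ^ (r.val + 1))) = c := by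
  simp only [addRow, hr, if_true, List.bind_eq_flatMap, List.pure_def, List.mem_flatMap,
    List.mem_singleton, mem_appendRow, List.mem_range]
  constructor
  · rintro ⟨_, ⟨b, hb, rfl⟩, d, hd, rfl⟩
    exact ⟨d, hd, b, by push_cast; rfl⟩
  · rintro ⟨d, hd, a, rfl⟩
    obtain ⟨b, hb, h⟩ := exists_natCast_eq_of_int hp (r.val + 1) a
    exact ⟨_, ⟨b, by simpa [hr] using hb, rfl⟩, d, hd, by rw [h]⟩

theorem mem_addRow_low {p s n : ℕ} (hp : 0 < p) {i₀ : Fin s} {A : GenMatrix p s (n + 1)}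
    {r : Fin s} (hr : r.val ≠ 0) (h : r.val + i₀.val < s)
    {c : Fin (n + 2) → ZMod (p ^ (r.val + 1))} :
    c ∈ addRow i₀ A r ↔
      (∃ z : Fin n → ℤ, (∀ k, (p : ℤ) ∣ z k) ∧ ∃ b : ℕ, 1 ≤ b ∧ b < p ∧
        column p r (Fin.snoc (α := fun _ => ℤ) z (b : ℤ)) = c) ∨
      ∃ d ∈ A r, ∃ a : ℤ,
        Fin.snoc (α := fun _ => ZMod (p ^ (r.val + 1))) d (a : ZMod (p ^ (r.val + 1))) = c := by
  simp only [addRow, hr, h, if_true, if_false, List.bind_eq_flatMap, List.pure_def,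
    List.mem_flatMap, List.mem_singleton, mem_appendRow, List.mem_range, List.mem_append,
    List.mem_range'_1, mem_mColumns hp, column_snoc]
  refine or_congr ⟨?_, ?_⟩ ⟨?_, ?_⟩
  · rintro ⟨_, ⟨b, hb, rfl⟩, _, ⟨z, hz, rfl⟩, rfl⟩
    exact ⟨z, hz, b, by omega, by omega, by push_cast; rfl⟩
  · rintro ⟨z, hz, b, hb1, hb2, rfl⟩
    exact ⟨_, ⟨b, by omega, rfl⟩, _, ⟨z, hz, rfl⟩, by push_cast; rfl⟩
  · rintro ⟨_, ⟨b, hb, rfl⟩, d, hd, rfl⟩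
    exact ⟨d, hd, b, by push_cast; rfl⟩
  · rintro ⟨d, hd, a, rfl⟩
    obtain ⟨b, hb, h⟩ := exists_natCast_eq_of_int hp (r.val + 1) a
    exact ⟨_, ⟨b, hb, rfl⟩, d, hd, by rw [h]⟩

theorem mem_addRow_high {p s n : ℕ} (hp : 0 < p) {i₀ : Fin s} {A : GenMatrix p s (n + 1)}
    {r : Fin s} (hr : r.val ≠ 0) (h : ¬ r.val + i₀.val < s)
    {c : Fin (n + 2) → ZMod (p ^ (r.val + 1))} :
    c ∈ addRow i₀ A r ↔ ∃ d ∈ A r, ∃ a : ℤ, (p : ℤ) ^ (r.val + 1 - (s - i₀.val)) ∣ a ∧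
      Fin.snoc (α := fun _ => ZMod (p ^ (r.val + 1))) d (a : ZMod (p ^ (r.val + 1))) = c := by
  have hi := i₀.isLt
  have he : r.val + i₀.val + 1 - s = r.val + 1 - (s - i₀.val) := by omega
  simp only [addRow, hr, h, if_false, List.bind_eq_flatMap, List.pure_def,
    List.mem_flatMap, List.mem_singleton, mem_appendRow, List.mem_range, he]
  constructor
  · rintro ⟨_, ⟨b, hb, rfl⟩, d, hd, rfl⟩
    exact ⟨d, hd, (p : ℤ) ^ (r.val + 1 - (s - i₀.val)) * b, dvd_mul_right _ _, by push_cast; rfl⟩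
  · rintro ⟨d, hd, a, ha, rfl⟩
    obtain ⟨b, hb, h⟩ := exists_natCast_eq hp (r.val + 1 - (s - i₀.val)) (s - i₀.val) a ha
    rw [show r.val + 1 - (s - i₀.val) + (s - i₀.val) = r.val + 1 by omega] at h
    exact ⟨_, ⟨b, hb, rfl⟩, d, hd, by rw [h]⟩

theorem rowExp_zero (s : ℕ) (l : List (Fin s)) : rowExp s l 0 = s := by
  induction l with
  | nil => rfl
  | cons i₀ l ih =>
    have : (0 : Fin ((i₀ :: l).length + 1)) = Fin.castSucc (0 : Fin (l.length + 1)) := rfl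
    rw [this, rowExp]
    exact (Fin.snoc_castSucc (α := fun _ => ℕ) _ _ _).trans ih

/-- Constructions are applied with nondecreasing index, so earlier rows have at least the order of
the new one. This makes the columns of `mColumns` satisfy the divisibility conditions. -/
theorem le_rowExp {s : ℕ} {l : List (Fin s)} {i : Fin s} (h : ∀ j ∈ l, j ≤ i) (k) :
    s - i.val ≤ rowExp s l k := by
  induction l with
  | nil => exact Nat.sub_le _ _
  | cons i₀ l ih =>
    refine Fin.lastCases ?_ (fun k => ?_) k
    · simp only [rowExp, List.length_cons, Fin.snoc_last]
      have : i₀.val ≤ i.val := h i₀ (by simp)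
      omega
    · simp only [rowExp, List.length_cons, Fin.snoc_castSucc]
      exact ih (fun j hj => h j (by simp [hj])) k

/-- Every admissible vector occurs among the columns, up to a factor congruent to `1`. -/
theorem exists_column_mem {p s : ℕ} (hp : p.Prime) {l : List (Fin s)} (r : Fin s)
    {z : Fin (l.length + 1) → ℤ} (hz : Admissible p r (rowExp s l) z) :
    ∃ θ : ℤ, (p : ℤ) ∣ θ - 1 ∧ column p r (fun k => θ * z k) ∈ buildMatrix p s l r := by
  induction l with
  | nil =>
    by_cases hr : r.val = 0
    · obtain ⟨b, hb, h⟩ := exists_natCast_eq_of_int hp.pos (r.val + 1) (z 0)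
      refine ⟨1, by simp, (mem_baseMatrix hp.pos).2 ⟨b, by simpa [hr] using hb, Or.inl hr, ?_⟩⟩
      unfold column
      congr 1
      funext k
      rw [Subsingleton.elim k 0]
      push_cast
      rw [h, one_mul]
    · obtain ⟨k, hk⟩ := hz.2.resolve_left hr
      obtain ⟨θ, hθ, b, hb1, hb2, h⟩ := exists_scale hp r hk
      refine ⟨θ, hθ, (mem_baseMatrix hp.pos).2 ⟨b, hb2, Or.inr hb1, ?_⟩⟩
      unfold column
      congr 1
      funext j
      rw [Subsingleton.elim (α := Fin 1) j k, h]
      push_cast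
      rfl
  | cons i₀ l ih =>
    have hsplit : ∀ θ : ℤ, column p r (fun k => θ * z k) =
        Fin.snoc (α := fun _ => ZMod (p ^ (r.val + 1)))
          (column p r fun k : Fin (l.length + 1) => θ * z k.castSucc)
          ((θ * z (Fin.last (l.length + 1)) : ℤ) : ZMod (p ^ (r.val + 1))) := by
      intro θ
      rw [← column_snoc]
      congr 1
      funext k
      refine Fin.lastCases ?_ (fun k => ?_) k <;> simp
    have hdiv : ∀ k : Fin (l.length + 1), (p : ℤ) ^ (r.val + 1 - rowExp s l k) ∣ z k.castSucc := by
      intro k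
      have := hz.1 k.castSucc
      simpa only [rowExp, List.length_cons, Fin.snoc_castSucc] using this
    have hlast : (p : ℤ) ^ (r.val + 1 - (s - i₀.val)) ∣ z (Fin.last (l.length + 1)) := by
      have := hz.1 (Fin.last (l.length + 1))
      simpa only [rowExp, List.length_cons, Fin.snoc_last] using this
    have hi := i₀.isLt
    by_cases hold : r.val = 0 ∨ ∃ k : Fin (l.length + 1), ¬ (p : ℤ) ∣ z k.castSucc
    · obtain ⟨θ, hθ, hmem⟩ := ih ⟨hdiv, hold⟩
      refine ⟨θ, hθ, ?_⟩
      rw [hsplit]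
      by_cases hr : r.val = 0
      · exact (mem_addRow_zero hp.pos hr).2 ⟨_, hmem, _, rfl⟩
      · by_cases h : r.val + i₀.val < s
        · exact (mem_addRow_low hp.pos hr h).2 (Or.inr ⟨_, hmem, _, rfl⟩)
        · exact (mem_addRow_high hp.pos hr h).2 ⟨_, hmem, _, hlast.mul_left θ, rfl⟩
    -- The only unit entry is the new one, so the column must come from `mColumns`.
    · push Not at hold
      obtain ⟨hr, hold⟩ := hold
      have hunit : ¬ (p : ℤ) ∣ z (Fin.last (l.length + 1)) := by
        obtain ⟨k, hk⟩ := hz.2.resolve_left hr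
        revert hk
        refine Fin.lastCases ?_ (fun k => ?_) k
        · exact id
        · exact fun hk => absurd (hold k) hk
      have h : r.val + i₀.val < s := by
        by_contra h
        exact hunit ((dvd_pow_self _ (by omega)).trans hlast)
      obtain ⟨θ, hθ, b, hb1, hb2, hb⟩ := exists_scale hp r hunit
      refine ⟨θ, hθ, (mem_addRow_low hp.pos hr h).2 (Or.inl ⟨fun k => θ * z k.castSucc,
        fun k => (hold k).mul_left θ, b, hb1, hb2, ?_⟩)⟩
      rw [hsplit, column_snoc, hb]
      push_cast
      rfl

/-- Every column comes from an admissible vector. -/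
theorem eq_column_of_mem {p s : ℕ} (hp : p.Prime) {l : List (Fin s)}
    (hl : l.Pairwise fun i j => j ≤ i) (r : Fin s)
    {c : Fin (l.length + 2) → ZMod (p ^ (r.val + 1))} (hc : c ∈ buildMatrix p s l r) :
    ∃ z : Fin (l.length + 1) → ℤ, (∀ k, (p : ℤ) ^ (r.val + 1 - rowExp s l k) ∣ z k) ∧
      (r.val = 0 ∨ ∃ k, 0 < z k ∧ z k < p) ∧ column p r z = c := by
  induction l with
  | nil =>
    obtain ⟨b, hb, hr, h⟩ := (mem_baseMatrix hp.pos).1 hc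
    refine ⟨fun _ => b, fun k => ?_,
      hr.imp_right fun h => ⟨0, Int.natCast_pos.2 h, Int.ofNat_lt.2 hb⟩, h⟩
    have := r.isLt
    simp [rowExp, show r.val + 1 - s = 0 by omega]
  | cons i₀ l ih =>
    rw [List.pairwise_cons] at hl
    have hi := i₀.isLt
    have hle := le_rowExp hl.1
    have old : ∀ d ∈ buildMatrix p s l r, ∀ a : ℤ, (p : ℤ) ^ (r.val + 1 - (s - i₀.val)) ∣ a →
        Fin.snoc (α := fun _ => ZMod (p ^ (r.val + 1))) d (a : ZMod (p ^ (r.val + 1))) = c →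
        ∃ z : Fin ((i₀ :: l).length + 1) → ℤ,
          (∀ k, (p : ℤ) ^ (r.val + 1 - rowExp s (i₀ :: l) k) ∣ z k) ∧
          (r.val = 0 ∨ ∃ k, 0 < z k ∧ z k < p) ∧ column p r z = c := by
      rintro d hd a ha rfl
      obtain ⟨z, hz1, hz2, rfl⟩ := ih hl.2 hd
      refine ⟨Fin.snoc (α := fun _ => ℤ) z a, fun k => ?_, hz2.imp_right ?_, column_snoc p r z a⟩
      · refine Fin.lastCases ?_ (fun k => ?_) k
        · simpa only [rowExp, List.length_cons, Fin.snoc_last] using ha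
        · simpa only [rowExp, List.length_cons, Fin.snoc_castSucc] using hz1 k
      · rintro ⟨k, hk⟩
        exact ⟨k.castSucc, by simpa using hk⟩
    by_cases hr : r.val = 0
    · obtain ⟨d, hd, a, h⟩ := (mem_addRow_zero hp.pos hr).1 hc
      exact old d hd a (by simp [show r.val + 1 - (s - i₀.val) = 0 by omega]) h
    · by_cases h : r.val + i₀.val < s
      · rcases (mem_addRow_low hp.pos hr h).1 hc with ⟨z, hz, b, hb1, hb2, hcol⟩ | ⟨d, hd, a, hcol⟩
        · refine ⟨Fin.snoc (α := fun _ => ℤ) z (b : ℤ), fun k => ?_,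
            Or.inr ⟨Fin.last (l.length + 1), ?_⟩, hcol⟩
          -- In these blocks all rows so far have order at least `p ^ (r + 1)`, so the divisibility
          -- condition is vacuous.
          · have : r.val + 1 - rowExp s (i₀ :: l) k = 0 := by
              refine Fin.lastCases ?_ (fun k => ?_) k
              · simp only [rowExp, List.length_cons, Fin.snoc_last]
                omega
              · simp only [rowExp, List.length_cons, Fin.snoc_castSucc]
                have := hle k
                omega
            simp [this]
          · have : Fin.snoc (α := fun _ => ℤ) z (b : ℤ) (Fin.last (l.length + 1)) = b :=
              Fin.snoc_last (α := fun _ => ℤ) _ _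
            exact ⟨by rw [this]; exact_mod_cast hb1, by rw [this]; exact_mod_cast hb2⟩
        · exact old d hd a (by simp [show r.val + 1 - (s - i₀.val) = 0 by omega]) hcol
      · obtain ⟨d, hd, a, ha, hcol⟩ := (mem_addRow_high hp.pos hr h).1 hc
        exact old d hd a ha hcol

/-! ### Sums of Gray images of codewords -/

/-- The entry, at the column `c`, of the codeword with coefficients `b`. -/
def wordAt {R : Type*} [Ring R] {n : ℕ} (b : Fin n → ℤ) (c : Fin n → R) : R :=
  ∑ k, (b k : R) * c k

theorem wordAt_add {R : Type*} [Ring R] {n : ℕ} (b b' : Fin n → ℤ) (c : Fin n → R) :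
    wordAt (b + b') c = wordAt b c + wordAt b' c := by
  simp [wordAt, add_mul, Finset.sum_add_distrib]

theorem wordAt_sub {R : Type*} [Ring R] {n : ℕ} (b b' : Fin n → ℤ) (c : Fin n → R) :
    wordAt (b - b') c = wordAt b c - wordAt b' c := by
  simp [wordAt, sub_mul, Finset.sum_sub_distrib]

theorem wordAt_column (p r : ℕ) {n : ℕ} (b : Fin (n + 1) → ℤ) (z : Fin n → ℤ) :
    wordAt b (column p r z) =
      (((p : ℤ) ^ r * b 0 + z ⬝ᵥ Fin.tail b : ℤ) : ZMod (p ^ (r + 1))) := by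
  simp only [wordAt, Fin.sum_univ_succ, column, Fin.cons_zero, Fin.cons_succ, dotProduct, Fin.tail]
  push_cast
  rw [mul_comm (b 0 : ZMod (p ^ (r + 1)))]
  congr 1
  exact Finset.sum_congr rfl fun k _ => mul_comm _ _

/-- The Gray images of the codewords with coefficients `b` and `b'` have the Gray image of the
codeword with coefficients `b''` as their sum. -/
def IsGraySum (p : ℕ) {s : ℕ} (l : List (Fin s)) (b b' b'' : Fin (l.length + 2) → ℤ) : Prop :=
  ∀ (r : Fin s), ∀ c ∈ buildMatrix p s l r,
    gray p r (wordAt b c) + gray p r (wordAt b' c) = gray p r (wordAt b'' c)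

theorem dvd_of_dvd_scale_mul {p : ℕ} {θ x : ℤ} {m : ℕ} (hθ : (p : ℤ) ∣ θ - 1)
    (h : (p : ℤ) ^ m ∣ θ * x) : (p : ℤ) ^ m ∣ x := by
  refine IsCoprime.dvd_of_dvd_mul_left (IsCoprime.pow_left ?_) h
  obtain ⟨k, hk⟩ := hθ
  exact ⟨-k, 1, by linear_combination hk⟩

theorem scale_dotProduct {n : ℕ} (θ : ℤ) (z t : Fin n → ℤ) :
    (fun k => θ * z k) ⬝ᵥ t = θ * (z ⬝ᵥ t) := by
  have := smul_dotProduct θ z t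
  rwa [smul_eq_mul] at this

theorem tail_sub {n : ℕ} (b b' : Fin (n + 1) → ℤ) :
    Fin.tail (b - b') = Fin.tail b - Fin.tail b' := rfl

/-- Where the entry of the first word is killed by `p`, the Gray map is additive; injectivity then
makes the entry of `b'' - b - b'` vanish. -/
theorem IsGraySum.dvd_of_torsion {p s : ℕ} (hp : p.Prime) {l : List (Fin s)}
    {b b' b'' : Fin (l.length + 2) → ℤ} (h : IsGraySum p l b b' b'') (r : Fin s)
    {z : Fin (l.length + 1) → ℤ} {θ : ℤ}
    (hmem : column p r (fun k => θ * z k) ∈ buildMatrix p s l r)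
    (htor : (p : ℤ) ^ (r.val + 1) ∣ p * (z ⬝ᵥ Fin.tail b)) :
    (p : ℤ) ^ (r.val + 1) ∣
      (p : ℤ) ^ r.val * (b'' - b - b') 0 + θ * (z ⬝ᵥ Fin.tail (b'' - b - b')) := by
  have h1 := h r _ hmem
  have hu : (p : ZMod (p ^ (r.val + 1))) * wordAt b (column p r fun k => θ * z k) = 0 := by
    rw [wordAt_column, scale_dotProduct, ← Int.cast_natCast, ← Int.cast_mul,
      ZMod.intCast_zmod_eq_zero_iff_dvd]
    obtain ⟨k, hk⟩ := htor
    push_cast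
    exact ⟨b 0 + θ * k, by linear_combination θ * hk⟩
  rw [← gray_add_of_torsion hp.one_lt hu] at h1
  have h2 := gray_injective hp.one_lt _ h1
  have h3 : wordAt (b'' - b - b') (column p r fun k => θ * z k) = 0 := by
    rw [wordAt_sub, wordAt_sub, ← h2]
    ring
  rw [wordAt_column, scale_dotProduct, ZMod.intCast_zmod_eq_zero_iff_dvd] at h3
  exact_mod_cast h3

theorem IsGraySum.dvd_zero {p s : ℕ} (hp : p.Prime) (hs : 0 < s) {l : List (Fin s)}
    {b b' b'' : Fin (l.length + 2) → ℤ} (h : IsGraySum p l b b' b'') :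
    (p : ℤ) ∣ (b'' - b - b') 0 := by
  -- The zero vector is admissible in block 0 and isolates the first coefficient.
  obtain ⟨θ, -, hmem⟩ := exists_column_mem hp (l := l) ⟨0, hs⟩ (z := 0) ⟨by simp, Or.inl rfl⟩
  have := h.dvd_of_torsion hp ⟨0, hs⟩ hmem (by simp)
  simpa using this

theorem IsGraySum.dvd_dotProduct {p s : ℕ} (hp : p.Prime) {l : List (Fin s)}
    {b b' b'' : Fin (l.length + 2) → ℤ} (h : IsGraySum p l b b' b'') (r : Fin s)
    {z : Fin (l.length + 1) → ℤ} (hz : Admissible p r (rowExp s l) z)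
    (htor : (p : ℤ) ^ (r.val + 1) ∣ p * (z ⬝ᵥ Fin.tail b)) :
    (p : ℤ) ^ (r.val + 1) ∣ z ⬝ᵥ Fin.tail (b'' - b - b') := by
  obtain ⟨θ, hθ, hmem⟩ := exists_column_mem hp r hz
  obtain ⟨k, hk⟩ := h.dvd_zero hp (by have := r.isLt; omega)
  have := h.dvd_of_torsion hp r hmem htor
  refine dvd_of_dvd_scale_mul hθ ((dvd_add_right ?_).1 this)
  exact ⟨k, by rw [hk]; ring⟩

/-- This is `gray_carry` read off at one column. The carry depends only on residues mod `p`, so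
neither the factor θ ≡ 1 nor the first row affects it. -/
theorem IsGraySum.dvd_dotProduct_add_carry {p s : ℕ} (hp : p.Prime) {l : List (Fin s)}
    {b b' b'' : Fin (l.length + 2) → ℤ} (h : IsGraySum p l b b' b'') {q : ℕ} (hq : q + 1 < s)
    {z : Fin (l.length + 1) → ℤ} (hz : Admissible p (q + 1) (rowExp s l) z) {X Y : ℤ}
    (hX : z ⬝ᵥ Fin.tail b = (p : ℤ) ^ q * X) (hY : z ⬝ᵥ Fin.tail b' = (p : ℤ) ^ q * Y) :
    (p : ℤ) ^ (q + 2) ∣ z ⬝ᵥ Fin.tail (b'' - b - b') + (p : ℤ) ^ (q + 1) * carry p X Y := by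
  obtain ⟨θ, hθ, hmem⟩ := exists_column_mem hp ⟨q + 1, hq⟩ hz
  obtain ⟨k, hk⟩ := h.dvd_zero hp (by omega)
  have h1 := h ⟨q + 1, hq⟩ _ hmem
  simp only [wordAt_column, scale_dotProduct] at h1
  rw [hX, hY, show (p : ℤ) ^ (q + 1) * b 0 + θ * ((p : ℤ) ^ q * X) =
      (p : ℤ) ^ q * (p * b 0 + θ * X) by ring,
    show (p : ℤ) ^ (q + 1) * b' 0 + θ * ((p : ℤ) ^ q * Y) =
      (p : ℤ) ^ q * (p * b' 0 + θ * Y) by ring, ← gray_carry hp.one_lt] at h1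
  have h2 := gray_injective hp.one_lt _ h1
  rw [ZMod.intCast_eq_intCast_iff_dvd_sub] at h2
  obtain ⟨t, ht⟩ := hθ
  rw [carry_congr (x' := X) (y' := Y) ⟨b 0 + t * X, by linear_combination X * ht⟩
    ⟨b' 0 + t * Y, by linear_combination Y * ht⟩] at h2
  push_cast at h2
  refine dvd_of_dvd_scale_mul (θ := θ) ⟨t, ht⟩ ?_
  obtain ⟨m, hm⟩ := h2
  have h3 : z ⬝ᵥ Fin.tail (b'' - b - b') =
      z ⬝ᵥ Fin.tail b'' - z ⬝ᵥ Fin.tail b - z ⬝ᵥ Fin.tail b' := by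
    simp only [tail_sub, dotProduct_sub]
  simp only [Pi.sub_apply] at hk
  rw [h3, hX, hY]
  exact ⟨m - k + t * carry p X Y, by
    linear_combination hm - (p : ℤ) ^ (q + 1) * hk + (p : ℤ) ^ (q + 1) * carry p X Y * ht⟩

theorem carry_neg_self {p : ℕ} (hp : 0 < p) {X : ℤ} (hX : ¬ (p : ℤ) ∣ X) : carry p X (-X) = 1 := by
  have hp' : (0 : ℤ) < p := by exact_mod_cast hp
  have h0 : X % p ≠ 0 := fun h => hX (Int.dvd_of_emod_eq_zero h)
  have h1 : -X % p ≠ 0 := fun h => hX (Int.dvd_neg.1 (Int.dvd_of_emod_eq_zero h))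
  have h2 := Int.emod_nonneg X hp'.ne'
  have h3 := Int.emod_nonneg (-X) hp'.ne'
  have h4 : (p : ℤ) ∣ X % p + -X % p := by
    apply Int.dvd_of_emod_eq_zero
    rw [← Int.add_emod]
    simp
  rw [carry, if_pos (Int.le_of_dvd (by omega) h4)]

theorem carry_two (X Y : ℤ) : carry 2 X Y = X % 2 * (Y % 2) := by
  unfold carry
  rcases Int.emod_two_eq_zero_or_one X with h | h <;>
    rcases Int.emod_two_eq_zero_or_one Y with h' | h' <;> simp [h, h']

theorem Admissible.lower {p r n : ℕ} {σ : Fin n → ℕ} {z : Fin n → ℤ}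
    (hz : Admissible p (r + 1) σ z) : Admissible p r σ z :=
  ⟨fun k => (pow_dvd_pow _ (by omega)).trans (hz.1 k), Or.inr (hz.2.resolve_left (by omega))⟩

/-! ### Codewords of order greater than `p` in the kernel -/

theorem Admissible.of_add {p r n : ℕ} {σ : Fin n → ℕ} {z d : Fin n → ℤ}
    (hz : Admissible p r σ z) (hd : ∀ k, (p : ℤ) ^ (r + 1 - σ k) ∣ d k)
    (hu : ∃ k, ¬ (p : ℤ) ∣ z k + d k) : Admissible p r σ (z + d) :=
  ⟨fun k => dvd_add (hz.1 k) (hd k), Or.inr hu⟩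

theorem dvd_single {n : ℕ} {f : Fin n → ℤ} {i : Fin n} {a : ℤ} (h : f i ∣ a) (k : Fin n) :
    f k ∣ (Pi.single i a : Fin n → ℤ) k := by
  rcases eq_or_ne k i with rfl | hk
  · simpa using h
  · simp [hk]

theorem admissible_single {p r n : ℕ} (hp : 1 < p) {σ : Fin n → ℕ} {i : Fin n}
    (hi : r + 1 ≤ σ i) : Admissible p r σ (Pi.single i 1) := by
  refine ⟨dvd_single (f := fun k => (p : ℤ) ^ (r + 1 - σ k)) (by simp [Nat.sub_eq_zero_of_le hi]),
    Or.inr ⟨i, ?_⟩⟩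
  rw [Pi.single_eq_same]
  intro h
  have := Int.le_of_dvd one_pos h
  omega

/-- The residues of `X` and `-X` always carry 1. For odd `p`, passing from `z` to `2z` keeps the
carry but doubles the entry of `b'' - b - b'`, which forces `p ∣ 1`. -/
theorem IsGraySum.eq_two {p s : ℕ} (hp : p.Prime) {l : List (Fin s)}
    {b b'' : Fin (l.length + 2) → ℤ} (h : IsGraySum p l b (-b) b'') {q : ℕ} (hq : q + 1 < s)
    {z : Fin (l.length + 1) → ℤ} (hz : Admissible p (q + 1) (rowExp s l) z) {X : ℤ}
    (hX : z ⬝ᵥ Fin.tail b = (p : ℤ) ^ q * X) (hX' : ¬ (p : ℤ) ∣ X) : p = 2 := by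
  by_contra h2
  have hpz : Prime (p : ℤ) := Nat.prime_iff_prime_int.1 hp
  have hp2 : ¬ (p : ℤ) ∣ 2 := by
    intro hd
    exact h2 ((Nat.prime_dvd_prime_iff_eq hp Nat.prime_two).1 (by exact_mod_cast hd))
  have hneg : ∀ z : Fin (l.length + 1) → ℤ, z ⬝ᵥ Fin.tail (-b) = -(z ⬝ᵥ Fin.tail b) := fun z =>
    dotProduct_neg z (Fin.tail b)
  have hz2 : Admissible p (q + 1) (rowExp s l) fun k => 2 * z k := by
    refine ⟨fun k => (hz.1 k).mul_left 2, Or.inr ?_⟩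
    obtain ⟨k, hk⟩ := hz.2.resolve_left (by omega)
    exact ⟨k, fun hd => (hpz.dvd_or_dvd hd).elim hp2 hk⟩
  have h1 := h.dvd_dotProduct_add_carry hp hq hz (X := X) (Y := -X) hX (by rw [hneg, hX]; ring)
  have h2 := h.dvd_dotProduct_add_carry hp hq hz2 (X := 2 * X) (Y := -(2 * X))
    (by rw [scale_dotProduct, hX]; ring) (by rw [hneg, scale_dotProduct, hX]; ring)
  rw [carry_neg_self hp.pos hX'] at h1
  rw [carry_neg_self hp.pos fun hd => (hpz.dvd_or_dvd hd).elim hp2 hX', scale_dotProduct] at h2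
  have h3 : (p : ℤ) ^ (q + 1) * p ∣ (p : ℤ) ^ (q + 1) * 1 := by
    obtain ⟨k1, h1⟩ := h1
    obtain ⟨k2, h2⟩ := h2
    exact ⟨2 * k1 - k2, by linear_combination 2 * h1 - h2⟩
  have h4 := (mul_dvd_mul_iff_left (pow_ne_zero _ hpz.ne_zero)).1 h3
  exact hpz.not_dvd_one h4

theorem two_dvd_carry_sub (X Y : ℤ) : 2 ∣ carry 2 X Y - X * Y := by
  rw [carry_two]
  apply Int.dvd_of_emod_eq_zero
  simp [Int.sub_emod, Int.mul_emod]

/-- For `p = 2`, sums of Gray images impose a bilinear relation. -/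
theorem IsGraySum.two_dvd_cross {s : ℕ} {l : List (Fin s)}
    {b b' b'' : Fin (l.length + 2) → ℤ} (h : IsGraySum 2 l b b' b'') {q : ℕ} (hq : q + 1 < s)
    {x y : Fin (l.length + 1) → ℤ} (hx : Admissible 2 (q + 1) (rowExp s l) x)
    (hy : Admissible 2 (q + 1) (rowExp s l) y) (hxy : Admissible 2 (q + 1) (rowExp s l) (x + y))
    {X X' Y Y' : ℤ} (hX : x ⬝ᵥ Fin.tail b = 2 ^ q * X) (hX' : y ⬝ᵥ Fin.tail b = 2 ^ q * X')
    (hY : x ⬝ᵥ Fin.tail b' = 2 ^ q * Y) (hY' : y ⬝ᵥ Fin.tail b' = 2 ^ q * Y') :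
    2 ∣ X * Y' + X' * Y := by
  obtain ⟨k1, h1⟩ := h.dvd_dotProduct_add_carry Nat.prime_two hq hx hX hY
  obtain ⟨k2, h2⟩ := h.dvd_dotProduct_add_carry Nat.prime_two hq hy hX' hY'
  obtain ⟨k3, h3⟩ := h.dvd_dotProduct_add_carry Nat.prime_two hq hxy (X := X + X') (Y := Y + Y')
    (by rw [add_dotProduct, hX, hX']; push_cast; ring)
    (by rw [add_dotProduct, hY, hY']; push_cast; ring)
  rw [add_dotProduct] at h3
  have h4 : (2 : ℤ) ^ (q + 1) * 2 ∣
      2 ^ (q + 1) * (carry 2 (X + X') (Y + Y') - carry 2 X Y - carry 2 X' Y') :=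
    ⟨k3 - k1 - k2, by push_cast at h1 h2 h3; linear_combination h3 - h1 - h2⟩
  have h5 := (mul_dvd_mul_iff_left (by positivity)).1 h4
  have e1 := two_dvd_carry_sub X Y
  have e2 := two_dvd_carry_sub X' Y'
  have e3 := two_dvd_carry_sub (X + X') (Y + Y')
  have : X * Y' + X' * Y = (carry 2 (X + X') (Y + Y') - carry 2 X Y - carry 2 X' Y') +
      (carry 2 X Y - X * Y) + (carry 2 X' Y' - X' * Y') -
      (carry 2 (X + X') (Y + Y') - (X + X') * (Y + Y')) := by ring
  rw [this]
  exact dvd_sub (dvd_add (dvd_add h5 e1) e2) e3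

theorem dotProduct_tail_cons_single {n : ℕ} (z : Fin n → ℤ) (i : Fin n) (a : ℤ) :
    z ⬝ᵥ Fin.tail (Fin.cons 0 (Pi.single i a) : Fin (n + 1) → ℤ) = z i * a := by
  rw [Fin.tail_cons, dotProduct_single]

/-- Two rows of order at least `2 ^ (q + 2)` rule out a kernel word. -/
theorem false_of_rowExp_ge {s : ℕ} {l : List (Fin s)} {b : Fin (l.length + 2) → ℤ}
    (hker : ∀ b', ∃ b'', IsGraySum 2 l b b' b'') {q : ℕ} (hq : q + 1 < s)
    (hdiv : ∀ z, Admissible 2 (q + 1) (rowExp s l) z → ∃ X, z ⬝ᵥ Fin.tail b = 2 ^ q * X)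
    {z : Fin (l.length + 1) → ℤ} (hz : Admissible 2 (q + 1) (rowExp s l) z) {X : ℤ}
    (hX : z ⬝ᵥ Fin.tail b = 2 ^ q * X) (hX' : ¬ 2 ∣ X) {i j : Fin (l.length + 1)} (hij : i ≠ j)
    (hi : q + 2 ≤ rowExp s l i) (hj : q + 2 ≤ rowExp s l j) : False := by
  have cross : ∀ (x y : Fin (l.length + 1) → ℤ) (k : Fin (l.length + 1)) (A B : ℤ),
      Admissible 2 (q + 1) (rowExp s l) x → Admissible 2 (q + 1) (rowExp s l) y →
      Admissible 2 (q + 1) (rowExp s l) (x + y) → x ⬝ᵥ Fin.tail b = 2 ^ q * A →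
      y ⬝ᵥ Fin.tail b = 2 ^ q * B → 2 ∣ A * y k + B * x k := by
    intro x y k A B hx hy hxy hA hB
    -- This test word contributes `2 ^ q * z k` at the column of `z`.
    obtain ⟨b'', h⟩ := hker (Fin.cons 0 (Pi.single k (2 ^ q)))
    exact h.two_dvd_cross hq hx hy hxy hA hB
      (by rw [dotProduct_tail_cons_single, mul_comm])
      (by rw [dotProduct_tail_cons_single, mul_comm])
  have dvd1 : ∀ k, q + 2 ≤ rowExp s l k → ∀ m,
      ((2 : ℕ) : ℤ) ^ (q + 1 + 1 - rowExp s l m) ∣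
        (Pi.single k 1 : Fin (l.length + 1) → ℤ) m := fun k hk =>
    (admissible_single (r := q + 1) one_lt_two hk).1
  have even : ∀ i j, i ≠ j → q + 2 ≤ rowExp s l i → q + 2 ≤ rowExp s l j → ∀ A,
      (Pi.single i 1 : Fin (l.length + 1) → ℤ) ⬝ᵥ Fin.tail b = 2 ^ q * A → 2 ∣ A := by
    intro i j hij hi hj A hA
    have ai : Admissible 2 (q + 1) (rowExp s l) (Pi.single i 1) := admissible_single one_lt_two hi
    have aj : Admissible 2 (q + 1) (rowExp s l) (Pi.single j 1) := admissible_single one_lt_two hj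
    obtain ⟨B, hB⟩ := hdiv _ aj
    have aij := ai.of_add (dvd1 j hj) ⟨i, by simp [hij]⟩
    have := cross _ _ j A B ai aj aij hA hB
    simpa [hij.symm] using this
  have final : ∀ k, q + 2 ≤ rowExp s l k →
      (∀ A, (Pi.single k 1 : Fin (l.length + 1) → ℤ) ⬝ᵥ Fin.tail b = 2 ^ q * A → 2 ∣ A) →
      (∃ m, ¬ ((2 : ℕ) : ℤ) ∣ z m + (Pi.single k 1 : Fin (l.length + 1) → ℤ) m) → False := by
    intro k hk hev hu
    have ak : Admissible 2 (q + 1) (rowExp s l) (Pi.single k 1) := admissible_single one_lt_two hk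
    obtain ⟨B, hB⟩ := hdiv _ ak
    have := cross _ _ k X B hz ak (hz.of_add (dvd1 k hk) hu) hX hB
    rw [Pi.single_eq_same, mul_one] at this
    exact hX' ((dvd_add_left ((hev B hB).mul_right _)).1 this)
  -- If `z + e_i` has only even entries, then `z j` is even and `z + e_j` has an odd entry at `j`.
  refine final i hi (even i j hij hi hj) ?_
  by_contra hu
  push Not at hu
  refine final j hj (even j i hij.symm hj hi) ⟨j, ?_⟩
  have := hu j
  rw [Pi.single_eq_of_ne hij.symm, add_zero] at this
  rw [Pi.single_eq_same, Nat.cast_ofNat]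
  rw [Nat.cast_ofNat] at this
  omega

/-- A second row of order between `4` and `2 ^ (q + 1)` rules out a kernel word. -/
theorem false_of_rowExp_le {s : ℕ} {l : List (Fin s)} {b : Fin (l.length + 2) → ℤ}
    (hker : ∀ b', ∃ b'', IsGraySum 2 l b b' b'') {q : ℕ} (hq : q + 1 < s)
    (hdiv : ∀ z, Admissible 2 (q + 1) (rowExp s l) z → ∃ X, z ⬝ᵥ Fin.tail b = 2 ^ q * X)
    {z : Fin (l.length + 1) → ℤ} (hz : Admissible 2 (q + 1) (rowExp s l) z) {X : ℤ}
    (hX : z ⬝ᵥ Fin.tail b = 2 ^ q * X) (hX' : ¬ 2 ∣ X)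
    (hlow : ∀ z, Admissible 2 q (rowExp s l) z → 2 ^ (q + 1) ∣ 2 * (z ⬝ᵥ Fin.tail b))
    {k : Fin (l.length + 1)} (hk : k ≠ 0)
    (hk2 : 2 ≤ rowExp s l k) (hkq : rowExp s l k ≤ q + 1) : False := by
  have h0 : rowExp s l 0 = s := rowExp_zero s l
  obtain ⟨u, hu⟩ : ∃ u, rowExp s l k = u + 2 := ⟨_, (Nat.sub_add_cancel hk2).symm⟩
  -- The least powers of 2 allowed in row `k` are `2 ^ v` in block `q` and `2 ^ (v + 1)` in block `q
  -- + 1`.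
  obtain ⟨v, hv⟩ : ∃ v, q + 1 = u + 2 + v := ⟨q + 1 - (u + 2), by omega⟩
  -- differences of the columns of the lower block
  have hlowdvd : ∀ b' b'', IsGraySum 2 l b b' b'' →
      (2 : ℤ) ^ (q + 2) ∣ Pi.single k (2 ^ (v + 1)) ⬝ᵥ Fin.tail (b'' - b - b') := by
    intro b' b'' h
    have a0 : Admissible 2 q (rowExp s l) (Pi.single 0 1) :=
      admissible_single one_lt_two (by omega)
    have a1 : Admissible 2 q (rowExp s l) (Pi.single 0 1 + Pi.single k (2 ^ v)) := by
      refine a0.of_add (dvd_single (f := fun m => ((2 : ℕ) : ℤ) ^ (q + 1 - rowExp s l m)) ?_)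
        ⟨0, by simp [hk.symm]⟩
      simp only [hu, show q + 1 - (u + 2) = v by omega]
      simp
    have h1 := h.dvd_dotProduct Nat.prime_two ⟨q, by omega⟩ a0 (by exact_mod_cast hlow _ a0)
    have h2 := h.dvd_dotProduct Nat.prime_two ⟨q, by omega⟩ a1 (by exact_mod_cast hlow _ a1)
    rw [add_dotProduct] at h2
    have h3 := (dvd_add_right h1).1 h2
    rw [single_dotProduct] at h3 ⊢
    obtain ⟨m, hm⟩ := h3
    push_cast at hm
    exact ⟨m, by linear_combination 2 * hm⟩
  have hadd : Admissible 2 (q + 1) (rowExp s l) (z + Pi.single k (2 ^ (v + 1))) := by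
    refine hz.of_add (dvd_single (f := fun m => ((2 : ℕ) : ℤ) ^ (q + 1 + 1 - rowExp s l m)) ?_) ?_
    · simp only [hu, show q + 1 + 1 - (u + 2) = v + 1 by omega]
      simp
    · obtain ⟨m, hm⟩ := hz.2.resolve_left (by omega)
      refine ⟨m, fun hd => hm ((dvd_add_left ?_).1 hd)⟩
      exact dvd_single (f := fun _ => ((2 : ℕ) : ℤ)) (by rw [pow_succ]; simp) m
  obtain ⟨D, hD⟩ := hdiv _ hadd
  -- By `hlowdvd`, `b'' - b - b'` has the same value modulo `2 ^ (q + 2)` at both vectors, so the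
  -- two carries agree mod 2.
  have rel : ∀ (b' : Fin (l.length + 2) → ℤ) (Y Y' : ℤ), z ⬝ᵥ Fin.tail b' = 2 ^ q * Y →
      (z + Pi.single k (2 ^ (v + 1))) ⬝ᵥ Fin.tail b' = 2 ^ q * Y' → 2 ∣ D * Y' - X * Y := by
    intro b' Y Y' hY hY'
    obtain ⟨b'', h⟩ := hker b'
    obtain ⟨k1, h1⟩ := h.dvd_dotProduct_add_carry Nat.prime_two hq hz hX hY
    obtain ⟨k2, h2⟩ := h.dvd_dotProduct_add_carry Nat.prime_two hq hadd hD hY'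
    obtain ⟨k3, h3⟩ := hlowdvd b' b'' h
    rw [add_dotProduct] at h2
    have h4 : (2 : ℤ) ^ (q + 1) * 2 ∣ 2 ^ (q + 1) * (carry 2 D Y' - carry 2 X Y) :=
      ⟨k2 - k1 - k3, by push_cast at h1 h2; linear_combination h2 - h1 - h3⟩
    have h5 := (mul_dvd_mul_iff_left (by positivity)).1 h4
    have e1 := two_dvd_carry_sub X Y
    have e2 := two_dvd_carry_sub D Y'
    have : D * Y' - X * Y =
        carry 2 D Y' - carry 2 X Y + (carry 2 X Y - X * Y) - (carry 2 D Y' - D * Y') := by ring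
    rw [this]
    exact dvd_sub (dvd_add h5 e1) e2
  have hDX : 2 ∣ D * D - X * X := rel b X D hX hD
  have hz' := hz.1 k
  rw [hu, show q + 1 + 1 - (u + 2) = v + 1 by omega] at hz'
  obtain ⟨Y, hY⟩ := hz'
  push_cast at hY
  have hqv : q = v + 1 + u := by omega
  -- Since `q = v + 1 + u`, the coefficient `2 ^ u` makes the shift by `2 ^ (v + 1)` change `Y` by
  -- exactly one; with `D` and `X` odd the parities clash.
  have := rel (Fin.cons 0 (Pi.single k (2 ^ u))) Y (Y + 1)
    (by rw [dotProduct_tail_cons_single, hY, hqv]; ring)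
    (by rw [dotProduct_tail_cons_single, Pi.add_apply, Pi.single_eq_same, hY, hqv]; ring)
  have hXo : X % 2 = 1 := by omega
  have hDo : D % 2 = 1 := by
    rcases Int.emod_two_eq_zero_or_one D with hd | hd
    · exfalso
      have := Int.emod_eq_zero_of_dvd hDX
      simp [Int.sub_emod, Int.mul_emod, hd, hXo] at this
    · exact hd
  have := Int.emod_eq_zero_of_dvd this
  rcases Int.emod_two_eq_zero_or_one Y with hy | hy <;>
    simp [Int.sub_emod, Int.mul_emod, Int.add_emod, hDo, hXo, hy] at this

/-- If a codeword of order greater than `p` lies in the kernel, then `p = 2` and at most one row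
has order greater than `2`. -/
theorem eq_two_and_rowExp_le_one {p s : ℕ} (hp : p.Prime) {l : List (Fin s)}
    (hl : l.Pairwise fun i j => j ≤ i) {b : Fin (l.length + 2) → ℤ}
    (hker : ∀ b', ∃ b'', IsGraySum p l b b' b'')
    (hne : ∃ r : Fin s, ∃ c ∈ buildMatrix p s l r, (p : ZMod (p ^ (r.val + 1))) * wordAt b c ≠ 0) :
    p = 2 ∧ ∀ k ≠ 0, rowExp s l k ≤ 1 := by
  classical
  have hex : ∃ r, r < s ∧ ∃ z, Admissible p r (rowExp s l) z ∧
      ¬ (p : ℤ) ^ (r + 1) ∣ p * (z ⬝ᵥ Fin.tail b) := by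
    obtain ⟨r, c, hc, h⟩ := hne
    obtain ⟨z, hz1, hz2, rfl⟩ := eq_column_of_mem hp hl r hc
    refine ⟨r, r.isLt, z, ⟨hz1, hz2.imp_right ?_⟩, fun hd => h ?_⟩
    · rintro ⟨k, hk0, hk⟩
      exact ⟨k, fun hd => absurd (Int.le_of_dvd hk0 hd) (by omega)⟩
    · rw [wordAt_column, ← Int.cast_natCast, ← Int.cast_mul, ZMod.intCast_zmod_eq_zero_iff_dvd]
      obtain ⟨m, hm⟩ := hd
      push_cast
      exact ⟨b 0 + m, by linear_combination hm⟩
  -- In the first block with non-torsion entries, minimality makes every entry a multiple of `p ^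
  -- q`, hence two-digit.
  obtain ⟨hr, z, hz, hzb⟩ := Nat.find_spec hex
  have hmin := fun m hm => Nat.find_min hex (m := m) hm
  generalize Nat.find hex = r at hr z hz hzb hmin
  obtain _ | q := r
  · exact absurd (by simp) hzb
  have hlow : ∀ z, Admissible p q (rowExp s l) z → (p : ℤ) ^ (q + 1) ∣ p * (z ⬝ᵥ Fin.tail b) := by
    intro z hz
    by_contra h
    exact hmin q (by omega) ⟨by omega, z, hz, h⟩
  have hp0 : (p : ℤ) ≠ 0 := by exact_mod_cast hp.ne_zero
  have hdiv : ∀ z, Admissible p (q + 1) (rowExp s l) z →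
      ∃ X, z ⬝ᵥ Fin.tail b = (p : ℤ) ^ q * X := by
    intro z hz
    have := hlow z hz.lower
    rw [pow_succ'] at this
    exact (mul_dvd_mul_iff_left hp0).1 this
  obtain ⟨X, hX⟩ := hdiv z hz
  have hX' : ¬ (p : ℤ) ∣ X := by
    rintro ⟨Y, rfl⟩
    exact hzb ⟨Y, by rw [hX]; ring⟩
  obtain ⟨b'', hb''⟩ := hker (-b)
  obtain rfl := hb''.eq_two hp hr hz hX hX'
  refine ⟨rfl, fun k hk => ?_⟩
  by_contra hk2
  rcases le_or_gt (rowExp s l k) (q + 1) with h | h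
  · exact false_of_rowExp_le hker hr (by exact_mod_cast hdiv) hz (by exact_mod_cast hX)
      (by exact_mod_cast hX') (by exact_mod_cast hlow) hk (by omega) h
  -- Row 0 has exponent `s ≥ q + 2` and is the second long row.
  · exact false_of_rowExp_ge hker hr (by exact_mod_cast hdiv) hz (by exact_mod_cast hX)
      (by exact_mod_cast hX') hk (by omega) (by rw [rowExp_zero]; omega)

/-! ### The linear codes -/

theorem natCast_digit_xor (k x y : ℕ) :
    (digit 2 k (x ^^^ y) : ZMod 2) = digit 2 k x + digit 2 k y := by
  have h : ∀ x, digit 2 k x = (x.testBit k).toNat := fun x => by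
    rw [digit, Nat.toNat_testBit]
  rw [h, h, h, Nat.testBit_xor]
  cases x.testBit k <;> cases y.testBit k <;> decide

theorem gray_xor (r x y : ℕ) :
    gray 2 r ((x ^^^ y : ℕ) : ZMod (2 ^ (r + 1))) =
      gray 2 r (x : ZMod (2 ^ (r + 1))) + gray 2 r (y : ZMod (2 ^ (r + 1))) := by
  funext c
  rw [Pi.add_apply, gray_natCast, gray_natCast, gray_natCast]
  simp only [natCast_digit_xor, add_mul, Finset.sum_add_distrib]
  ring

/-- Over ℤ_2, digits add by exclusive or. Reducing modulo `2 ^ s` first gives representatives valid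
in all blocks, so one integer `w` serves them all. -/
theorem exists_gray_add (s : ℕ) (x y : ℤ) : ∃ w : ℤ, ∀ r < s,
    gray 2 r (x : ZMod (2 ^ (r + 1))) + gray 2 r (y : ZMod (2 ^ (r + 1))) =
      gray 2 r (w : ZMod (2 ^ (r + 1))) := by
  have rep : ∀ x : ℤ, ∃ n : ℕ, ∀ r < s, (x : ZMod (2 ^ (r + 1))) = (n : ZMod (2 ^ (r + 1))) := by
    intro x
    refine ⟨(x % 2 ^ s).toNat, fun r hr => ?_⟩
    rw [← Int.cast_natCast, Int.toNat_of_nonneg (Int.emod_nonneg _ (by positivity)),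
      eq_comm, ZMod.intCast_eq_intCast_iff_dvd_sub]
    push_cast
    exact (pow_dvd_pow 2 hr).trans Int.dvd_self_sub_emod
  obtain ⟨m, hm⟩ := rep x
  obtain ⟨n, hn⟩ := rep y
  refine ⟨(m ^^^ n : ℕ), fun r hr => ?_⟩
  rw [hm r hr, hn r hr, Int.cast_natCast, gray_xor]

theorem gray_add_add_of_torsion {p r : ℕ} (hp : 1 < p) {u v x y w : ZMod (p ^ (r + 1))}
    (hu : (p : ZMod _) * u = 0) (hv : (p : ZMod _) * v = 0)
    (h : gray p r x + gray p r y = gray p r w) :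
    gray p r (u + x) + gray p r (v + y) = gray p r (u + v + w) := by
  rw [gray_add_of_torsion hp hu, gray_add_of_torsion hp hv,
    gray_add_of_torsion hp (by rw [mul_add, hu, hv, add_zero]), gray_add_of_torsion hp hu, ← h]
  abel

/-- If `p = 2` and only one row has order greater than `2`, sums of Gray images of codewords are
Gray images of codewords. -/
theorem exists_isGraySum {s : ℕ} {l : List (Fin s)} (hl : l.Pairwise fun i j => j ≤ i)
    (hle : ∀ k ≠ 0, rowExp s l k ≤ 1) (b b' : Fin (l.length + 2) → ℤ) :
    ∃ b'', IsGraySum 2 l b b' b'' := by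
  obtain ⟨w, hw⟩ := exists_gray_add s (b 1) (b' 1)
  -- Coefficients of the rows of order at most 2 simply add; only index 1, the row of order `2 ^ s`,
  -- needs the exclusive or.
  refine ⟨Function.update (b + b') 1 w, fun r c hc => ?_⟩
  obtain ⟨z, hz1, hz2, rfl⟩ := eq_column_of_mem Nat.prime_two hl r hc
  by_cases hr : r.val = 0
  · have tor : ∀ x : ZMod (2 ^ (r.val + 1)), ((2 : ℕ) : ZMod (2 ^ (r.val + 1))) * x = 0 := by
      intro x
      have : ((2 : ℕ) : ZMod (2 ^ (r.val + 1))) = 0 := by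
        rw [ZMod.natCast_eq_zero_iff, hr]
        exact dvd_refl 2
      rw [this, zero_mul]
    have hw' : (w : ZMod (2 ^ (r.val + 1))) = b 1 + b' 1 := by
      apply gray_injective one_lt_two
      rw [← hw r r.isLt, gray_add_of_torsion one_lt_two (tor _)]
    rw [← gray_add_of_torsion one_lt_two (tor _), ← wordAt_add]
    congr 1
    refine Finset.sum_congr rfl fun k _ => ?_
    rcases eq_or_ne k 1 with rfl | hk
    · simp [hw']
    · simp [hk]
  -- The other rows have even entries in this block, so the entry strictly between 0 and 2 lies in
  -- row 0 of `z`. Every codeword entry is then `b 1` plus a 2-torsion element.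
  · have hz0 : z 0 = 1 := by
      obtain ⟨k, hk⟩ := hz2.resolve_left hr
      have hk1 : z k = 1 := by push_cast at hk; omega
      rcases eq_or_ne k 0 with rfl | hk0
      · exact hk1
      · have := hz1 k
        have h2 := (dvd_pow_self ((2 : ℕ) : ℤ)
          (show r.val + 1 - rowExp s l k ≠ 0 by have := hle k hk0; omega)).trans this
        rw [hk1] at h2
        norm_num at h2
    have split : ∀ b : Fin (l.length + 2) → ℤ, wordAt b (column 2 r z) =
        wordAt (Function.update b 1 0) (column 2 r z) + (b 1 : ZMod (2 ^ (r.val + 1))) := by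
      intro b
      have h1 : b = Function.update b 1 0 + Pi.single 1 (b 1) := by
        funext k
        rcases eq_or_ne k 1 with rfl | hk
        · simp
        · simp [hk]
      conv_lhs => rw [h1]
      rw [wordAt_add]
      congr 1
      unfold wordAt
      rw [Finset.sum_eq_single 1]
      · have : column 2 r z 1 = (z 0 : ZMod (2 ^ (r.val + 1))) := rfl
        rw [this, hz0]
        simp
      · intro k _ hk
        simp [hk]
      · simp
    have tor : ∀ b : Fin (l.length + 2) → ℤ, ((2 : ℕ) : ZMod (2 ^ (r.val + 1))) *
        wordAt (Function.update b 1 0) (column 2 r z) = 0 := by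
      intro b
      unfold wordAt
      rw [Finset.mul_sum]
      refine Finset.sum_eq_zero fun k _ => ?_
      rw [mul_left_comm]
      rcases eq_or_ne k 1 with rfl | hk1
      · simp
      · refine mul_eq_zero_of_right _ ?_
        have hpow : ((2 : ℕ) : ZMod (2 ^ (r.val + 1))) * ((2 : ℕ) : ZMod (2 ^ (r.val + 1))) ^ r.val
            = 0 := by
          rw [← pow_succ', ← Nat.cast_pow, ZMod.natCast_self]
        refine Fin.cases (fun _ => hpow) (fun k hk1 => ?_) k hk1
        have hk0 : k ≠ 0 := fun h => hk1 (by rw [h]; rfl)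
        obtain ⟨m, hm⟩ := (pow_dvd_pow ((2 : ℕ) : ℤ)
          (show r.val ≤ r.val + 1 - rowExp s l k by have := hle k hk0; omega)).trans (hz1 k)
        have : column 2 r z k.succ = (z k : ZMod (2 ^ (r.val + 1))) := rfl
        rw [this, hm, Int.cast_mul, Int.cast_pow, Int.cast_natCast, ← mul_assoc, hpow, zero_mul]
    rw [split b, split b', split (Function.update (b + b') 1 w),
      gray_add_add_of_torsion one_lt_two (tor b) (tor b') (hw r r.isLt), ← wordAt_add]
    congr 3
    · funext k
      rcases eq_or_ne k 1 with rfl | hk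
      · simp
      · simp [hk]

/-! ### The code as a subset of the mixed space -/

/-- The codeword with coefficients `b`. -/
def GenMatrix.word {p s n : ℕ} (A : GenMatrix p s n) (b : Fin n → ℤ) : MixedSpace p s A.numCols :=
  fun r i => wordAt b ((A r).get i)

theorem GenMatrix.mem_code {p s n : ℕ} (A : GenMatrix p s n) (u : MixedSpace p s A.numCols) :
    u ∈ A.code ↔ ∃ b : Fin n → ℤ, A.word b = u := by
  rw [GenMatrix.code, ← Submodule.span_int_eq_addSubgroupClosure, Submodule.mem_toAddSubgroup,
    Submodule.mem_span_range_iff_exists_fun]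
  refine exists_congr fun b => ?_
  have : ∑ k, b k • A.row k = A.word b := by
    funext r i
    simp [GenMatrix.word, wordAt, GenMatrix.row, Finset.sum_apply]
  rw [this]

theorem grayMap_add_of_torsion {p s : ℕ} (hp : 1 < p) {α : Fin s → ℕ} {u : MixedSpace p s α}
    (hu : p • u = 0) (v : MixedSpace p s α) :
    grayMap p s α (u + v) = grayMap p s α u + grayMap p s α v := by
  funext x
  have h : (p : ZMod (p ^ (x.1.val + 1))) * u x.1 x.2.1 = 0 := by
    have := congrFun (congrFun hu x.1) x.2.1
    simpa using this
  exact congrFun (gray_add_of_torsion hp h _) _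

theorem grayMap_zero {p s : ℕ} (α : Fin s → ℕ) : grayMap p s α 0 = 0 := by
  funext x
  exact congrFun (gray_zero _ _) _

theorem addOrderOf_le_iff {p s : ℕ} (hp : p.Prime) {α : Fin s → ℕ} (u : MixedSpace p s α) :
    addOrderOf u ≤ p ↔ p • u = 0 := by
  constructor
  · intro h
    -- Orders are therefore powers of `p`; the default value 0 for infinite order never occurs.
    have hpow : p ^ s • u = 0 := by
      funext r i
      have : ((p ^ s : ℕ) : ZMod (p ^ (r.val + 1))) = 0 := by
        rw [ZMod.natCast_eq_zero_iff]
        exact pow_dvd_pow p r.isLt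
      rw [Pi.smul_apply, Pi.smul_apply, nsmul_eq_mul, this, zero_mul]
      rfl
    obtain ⟨k, -, hk⟩ := (Nat.dvd_prime_pow hp).1 (addOrderOf_dvd_of_nsmul_eq_zero hpow)
    apply addOrderOf_dvd_iff_nsmul_eq_zero.1
    rw [hk] at h ⊢
    have : k ≤ 1 := (Nat.pow_le_pow_iff_right hp.one_lt).1 (by simpa using h)
    simpa using pow_dvd_pow p this
  · intro h
    exact Nat.le_of_dvd hp.pos (addOrderOf_dvd_of_nsmul_eq_zero h)

/-- A nonempty code over `ℤ_p` that is closed under addition is linear. -/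
theorem isLinearCode_of_add {p : ℕ} [NeZero p] {ι : Type*} {C : Set (ι → ZMod p)} (h0 : 0 ∈ C)
    (hadd : ∀ x ∈ C, ∀ y ∈ C, x + y ∈ C) : IsLinearCode C := by
  let M : AddSubmonoid (ι → ZMod p) := ⟨⟨C, fun {x y} hx hy => hadd x hx y hy⟩, h0⟩
  refine ⟨⟨M, fun c x hx => ?_⟩, rfl⟩
  have : c • x = c.val • x := by
    funext i
    simp
  rw [this]
  exact M.nsmul_mem hx _

theorem isGraySum_of_grayMap_eq {p s : ℕ} {l : List (Fin s)} {b b' b'' : Fin (l.length + 2) → ℤ}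
    (h : grayMap p s _ ((buildMatrix p s l).word b) + grayMap p s _ ((buildMatrix p s l).word b') =
      grayMap p s _ ((buildMatrix p s l).word b'')) :
    IsGraySum p l b b' b'' := by
  intro r c hc
  obtain ⟨i, rfl⟩ := List.mem_iff_get.1 hc
  funext x
  exact congrFun h ⟨r, i, x⟩

/-! ### The kernel of the Gray image -/

theorem codeKernel_image_code {p s : ℕ} (hp : p.Prime) {l : List (Fin s)}
    (hl : l.Pairwise fun i j => j ≤ i)
    (hnonlinear : ¬ IsLinearCode (grayMap p s (buildMatrix p s l).numCols ''
      ((buildMatrix p s l).code : Set (MixedSpace p s (buildMatrix p s l).numCols)))) :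
    codeKernel (grayMap p s (buildMatrix p s l).numCols ''
      ((buildMatrix p s l).code : Set (MixedSpace p s (buildMatrix p s l).numCols))) =
    grayMap p s (buildMatrix p s l).numCols '' wordsOfOrderLE (buildMatrix p s l).code p := by
  have : NeZero p := ⟨hp.ne_zero⟩
  set H := (buildMatrix p s l).code
  set Φ := grayMap p s (buildMatrix p s l).numCols
  have h0 : (0 : GrayCoord p s (buildMatrix p s l).numCols → ZMod p) ∈ Φ '' (H : Set _) :=
    ⟨0, H.zero_mem, grayMap_zero _⟩
  ext x
  constructor
  · intro hx
    have hx' : ∀ y ∈ Φ '' (H : Set _), x + y ∈ Φ '' (H : Set _) := fun y hy => by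
      have hx : (fun c => x + c) '' (Φ '' (H : Set _)) = Φ '' (H : Set _) := hx
      rw [← hx]
      exact ⟨y, hy, rfl⟩
    obtain ⟨u, hu, rfl⟩ : x ∈ Φ '' (H : Set _) := by simpa using hx' 0 h0
    refine ⟨u, ⟨hu, ?_⟩, rfl⟩
    rw [addOrderOf_le_iff hp]
    by_contra hpu
    obtain ⟨b, rfl⟩ := (GenMatrix.mem_code _ u).1 hu
    have hker : ∀ b', ∃ b'', IsGraySum p l b b' b'' := by
      intro b'
      obtain ⟨w, hw, hsum⟩ := hx' _ ⟨_, (GenMatrix.mem_code _ _).2 ⟨b', rfl⟩, rfl⟩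
      obtain ⟨b'', rfl⟩ := (GenMatrix.mem_code _ w).1 hw
      exact ⟨b'', isGraySum_of_grayMap_eq hsum.symm⟩
    have hne : ∃ r : Fin s, ∃ c ∈ buildMatrix p s l r,
        (p : ZMod (p ^ (r.val + 1))) * wordAt b c ≠ 0 := by
      by_contra hall
      push Not at hall
      apply hpu
      funext r i
      rw [Pi.smul_apply, Pi.smul_apply, nsmul_eq_mul]
      exact hall r _ (List.get_mem _ i)
    obtain ⟨rfl, hle⟩ := eq_two_and_rowExp_le_one hp hl hker hne
    refine hnonlinear (isLinearCode_of_add h0 ?_)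
    rintro _ ⟨v, hv, rfl⟩ _ ⟨v', hv', rfl⟩
    obtain ⟨c, rfl⟩ := (GenMatrix.mem_code _ v).1 hv
    obtain ⟨c', rfl⟩ := (GenMatrix.mem_code _ v').1 hv'
    obtain ⟨c'', h⟩ := exists_isGraySum hl hle c c'
    refine ⟨_, (GenMatrix.mem_code _ _).2 ⟨c'', rfl⟩, ?_⟩
    funext x
    exact (congrFun (h x.1 _ (List.get_mem _ x.2.1)) x.2.2).symm
  · rintro ⟨u, ⟨hu, hord⟩, rfl⟩
    rw [addOrderOf_le_iff hp] at hord
    have hadd := grayMap_add_of_torsion hp.one_lt hord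
    apply Set.Subset.antisymm
    · rintro _ ⟨_, ⟨v, hv, rfl⟩, rfl⟩
      exact ⟨u + v, H.add_mem hu hv, hadd v⟩
    · rintro _ ⟨v, hv, rfl⟩
      refine ⟨_, ⟨v - u, H.sub_mem hv hu, rfl⟩, ?_⟩
      have := hadd (v - u)
      rw [add_sub_cancel] at this
      exact this.symm

/-- `buildMatrix` consumes the reversed list, whose resulting order is what `eq_column_of_mem`
requires. -/
theorem pairwise_steps (s : ℕ) (t : Fin s → ℕ) : (steps s t).Pairwise fun i j => i ≤ j := by
  unfold steps
  rw [List.pairwise_flatMap]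
  refine ⟨fun i _ => List.pairwise_replicate.2 (Or.inr le_rfl), ?_⟩
  refine (List.pairwise_lt_finRange s).imp fun {i j} hij x hx y hy => ?_
  rw [List.eq_of_mem_replicate hx, List.eq_of_mem_replicate hy]
  exact hij.le

end GHCode

theorem theorem4 (p s : ℕ) (hp : p.Prime) (hs : 2 ≤ s) (t : Fin s → ℕ)
    (ht_first : 1 ≤ t ⟨0, by omega⟩) (ht_last : 1 ≤ t ⟨s - 1, by omega⟩)
    (hnonlinear : ¬ GHCode.IsLinearCode
      (GHCode.grayMap p s (GHCode.ghLengths p s t) ''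
        (GHCode.ghCode p s t : Set (GHCode.MixedSpace p s (GHCode.ghLengths p s t))))) :
    GHCode.codeKernel
      (GHCode.grayMap p s (GHCode.ghLengths p s t) ''
        (GHCode.ghCode p s t : Set (GHCode.MixedSpace p s (GHCode.ghLengths p s t)))) =
      GHCode.grayMap p s (GHCode.ghLengths p s t) ''
        GHCode.wordsOfOrderLE (GHCode.ghCode p s t) p := by
  exact GHCode.codeKernel_image_code hp (List.pairwise_reverse.2 (GHCode.pairwise_steps s t))
    hnonlinear
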